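/- **Setting.** Let $(\varepsilon_{\boldsymbol i})_{\boldsymbol i\in\mathbb Z^3}$ be a weakly stationary, square integrable random field with $\mathbb E\,\varepsilon_{\boldsymbol i}=0$ satisfying a functional central limit theorem: for some $\sigma>0$, $$Z_n(v)=(n_1n_2n_3)^{-1/2}\sum_{i_1=1}^{\lfloor n_1v_1\rfloor}\sum_{i_2=1}^{\lfloor n_2v_2\rfloor}\sum_{i_3=1}^{\lfloor n_3v_3\rfloor}\varepsilon_{i_1,i_2,i_3}\ \Rightarrow\ \sigma B(v),\qquad v\in[0,1]^3,$$ weakly in the Skorohod space $D[0,1]^3$ as $\min_i n_i\to\infty$, where $B$ is standard Brownian motion on $[0,1]^3$: almost surely continuous, zero on the faces $\{v_j=0\}$, with independent centred normal increments around disjoint blocks, the variance being the volume of the block. Let $\tau_j=\tau_{j,n_j}>0$ ($j=1,2,3$) be sampling periods with $n_j\tau_j\to\overline\tau_j\in(0,\infty)$ as $n_j\to\infty$, and let $0<s_0<1$, $c_M>0$ and $0<\Omega_1,\Omega_2,\Omega_3<\infty$. Put $\varphi(x)=\prod_{j=1}^3\frac{\sin(\Omega_jx_j)}{\pi x_j}$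 (a factor equals $\Omega_j/\pi$ at $x_j=0$). The observations are $y_{\boldsymbol l}=f(l_1\tau_1,l_2\tau_2,l_3\tau_3)+\varepsilon_{\boldsymbol l}$, $1\le l_j\le n_j$, and $f_0$ is a given reference signal. $P_0$ denotes probability under the null hypothesis $f=f_0$, meaning equality on $[0,\overline\tau_1]\times[0,\overline\tau_2]\times[0,\overline\tau_3]$ and at all sampling points (so in particular there is no change before time $s_0\overline\tau_1$). With $$\mathcal F_n(s,t,r_2,r_3)=\sqrt{\tau_1\tau_2\tau_3}\sum_{l_1=1}^{\lfloor n_1s\rfloor}\sum_{l_2=1}^{n_2}\sum_{l_3=1}^{n_3}\bigl[y_{\boldsymbol l}-f_0(l_1\tau_1,l_2\tau_2,l_3\tau_3)\bigr]\,\varphi(t-l_1\tau_1,r_2-l_2\tau_2,r_3-l_3\tau_3)$$ let $$\mathcal M_n=\min\Bigl\{\lfloor n_1s_0\rfloor\le k\le n_1:\ \max_{0\le t\le\overline\tau_1k/n_1}\ \max_{r_2\in[0,\overline\tau_2],\,r_3\in[0,\overline\tau_3]}\bigl|\mathcal F_n(k/n_1,t,r_2,r_3)\bigr|>c_M\Bigr\},\qquad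 \min\emptyset=\infty .$$ **Theorem.** There is a zero-mean Gaussian process $\mathcal F$ on $[s_0,1]\times[0,\overline\tau_1]\times[0,\overline\tau_2]\times[0,\overline\tau_3]$ with almost surely continuous sample paths and covariance function $$\operatorname{Cov}\bigl(\mathcal F(s,t,r_2,r_3),\mathcal F(s',t',r_2',r_3')\bigr)=\sigma^2\overline\tau_1\overline\tau_2\overline\tau_3\int_0^{\min\{s,s'\}}\!\!\int_0^1\!\!\int_0^1\varphi(t-\overline\tau_1z_1,r_2-\overline\tau_2z_2,r_3-\overline\tau_3z_3)\,\varphi(t'-\overline\tau_1z_1,r_2'-\overline\tau_2z_2,r_3'-\overline\tau_3z_3)\,dz_3\,dz_2\,dz_1,$$ and for every such process $$\lim_{\min_i n_i\to\infty}P_0\Bigl(\frac{\mathcal M_n}{n_1}<1\Bigr)=P\Bigl(\sup_{s_0<s\le1}\ \sup_{0\le t\le s\overline\tau_1}\ \sup_{r_2\in[0,\overline\tau_2],\,r_3\in[0,\overline\tau_3]}\bigl|\mathcal F(s,t,r_2,r_3)\bigr|>c_M\Bigr).$$ -/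

import Mathlib

open MeasureTheory ProbabilityTheory Filter Topology
open scoped ENNReal NNReal unitInterval

noncomputable section

/-! ## The Skorohod space of functions on the cube `[0,1]^q` -/

/-- The quadrant `Q_{R_1,…,R_q}(t)` in `[0,1]^q`: the relation `R_p` is `<` if `p ∈ R`
and `≥` if `p ∉ R`. -/
def quadrant {q : ℕ} (R : Finset (Fin q)) (t : Fin q → I) : Set (Fin q → I) :=
  {s | ∀ p, if p ∈ R then s p < t p else t p ≤ s p}

/-- Functions on `[0,1]^q` that are continuous from above with limits from below:
all quadrant limits exist (no condition at an empty quadrant), and the value at `t` is the limit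
over the quadrant in which all relations are `≥`. -/
def IsSkorohod {q : ℕ} (f : (Fin q → I) → ℝ) : Prop :=
  ∀ t, (∀ R, ∃ l, Tendsto f (𝓝[quadrant R t] t) (𝓝 l)) ∧ Tendsto f (𝓝[quadrant ∅ t] t) (𝓝 (f t))

/-- The Skorohod space `D[0,1]^q`. -/
@[ext]
structure SkorohodSpace (q : ℕ) where
  toFun : (Fin q → I) → ℝ
  isSkorohod : IsSkorohod toFun

instance (q : ℕ) : CoeFun (SkorohodSpace q) fun _ => (Fin q → I) → ℝ := ⟨SkorohodSpace.toFun⟩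

/-- The coordinatewise time change of `[0,1]^q` given by increasing bijections of `[0,1]`. -/
def timeChange {q : ℕ} (lam : Fin q → (I ≃o I)) (t : Fin q → I) : Fin q → I :=
  fun j => lam j (t j)

/-- The Skorohod distance: the infimum, over all coordinatewise time changes `lam`, of the maximum
of `sup_t |x(t) - y(lam t)|` and `sup_t |lam t - t|`. -/
def skorohodDist {q : ℕ} (x y : SkorohodSpace q) : ℝ≥0∞ :=
  ⨅ lam : Fin q → (I ≃o I),
    max (⨆ t, edist (x t) (y (timeChange lam t))) (⨆ j, ⨆ t, edist (lam j t) t)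

instance (q : ℕ) : PseudoEMetricSpace (SkorohodSpace q) where
  edist := skorohodDist
  edist_self x := by
    refine le_antisymm ?_ zero_le
    refine iInf_le_of_le (fun _ => OrderIso.refl I) ?_
    have h : ∀ t : Fin q → I, timeChange (fun _ => OrderIso.refl I) t = t := fun _ => rfl
    simp [h]
  edist_comm := by
    have key : ∀ x y : SkorohodSpace q, skorohodDist x y ≤ skorohodDist y x := by
      intro x y
      refine le_iInf fun lam => ?_
      refine iInf_le_of_le (fun j => (lam j).symm) (max_le_max ?_ ?_)
      · refine iSup_le fun t => ?_
        refine le_iSup_of_le (timeChange (fun j => (lam j).symm) t) ?_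
        have h : timeChange lam (timeChange (fun j => (lam j).symm) t) = t :=
          funext fun j => (lam j).apply_symm_apply (t j)
        rw [edist_comm, h]
      · refine iSup_mono fun j => iSup_le fun t => ?_
        refine le_iSup_of_le ((lam j).symm t) ?_
        rw [edist_comm]
        simp
    exact fun x y => le_antisymm (key x y) (key y x)
  edist_triangle x y z := by
    unfold skorohodDist
    rw [ENNReal.iInf_add]
    refine le_iInf fun lam => ?_
    rw [ENNReal.add_iInf]
    refine le_iInf fun mu => ?_
    refine iInf_le_of_le (fun j => (lam j).trans (mu j)) (max_le ?_ ?_)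
    · refine iSup_le fun t => ?_
      refine (edist_triangle _ (y (timeChange lam t)) _).trans (add_le_add ?_ ?_)
      · exact le_max_of_le_left (le_iSup (fun t => edist (x t) (y (timeChange lam t))) t)
      · exact le_max_of_le_left
          (le_iSup (fun t => edist (y t) (z (timeChange mu t))) (timeChange lam t))
    · refine iSup_le fun j => iSup_le fun t => ?_
      refine (edist_triangle _ (lam j t) _).trans ?_
      rw [add_comm]
      refine add_le_add ?_ ?_
      · exact le_max_of_le_right (le_iSup₂_of_le j t le_rfl)
      · exact le_max_of_le_right (le_iSup₂_of_le j (lam j t) le_rfl)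

instance (q : ℕ) : MeasurableSpace (SkorohodSpace q) := borel _

instance (q : ℕ) : BorelSpace (SkorohodSpace q) := ⟨rfl⟩

instance (q : ℕ) : SMul ℝ (SkorohodSpace q) :=
  ⟨fun c f => ⟨fun t => c * f t, fun t =>
    ⟨fun R => by
      obtain ⟨l, hl⟩ := (f.isSkorohod t).1 R
      exact ⟨c * l, hl.const_mul c⟩, (f.isSkorohod t).2.const_mul c⟩⟩⟩

/-! ## Brownian motion on the cube -/

/-- The `q`-fold alternating sum `Δ(f; a, b) = ∑_v (-1)^|v| f(a_v : b_{-v})`, i.e. the increment of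
`f` around the block `∏ (a_j, b_j]`. -/
def alternatingSum {q : ℕ} (f : (Fin q → I) → ℝ) (a b : Fin q → I) : ℝ :=
  ∑ v : Finset (Fin q), (-1) ^ v.card * f (v.piecewise a b)

/-- The block `∏ (a_j, b_j]`. -/
def block {q : ℕ} (a b : Fin q → I) : Set (Fin q → I) :=
  Set.univ.pi fun j => Set.Ioc (a j) (b j)

/-- Standard Brownian motion on `[0,1]^q`: almost surely continuous and zero on the
lower faces of the cube, with independent centred normal increments around disjoint blocks, the
variance being the volume of the block. -/
structure IsBrownianSheet {q : ℕ} {Ω : Type*} [MeasurableSpace Ω]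
    (B : Ω → (Fin q → I) → ℝ) (P : Measure Ω) : Prop where
  continuous_paths : ∀ᵐ ω ∂P, Continuous (B ω)
  lower_faces : ∀ᵐ ω ∂P, ∀ t, (∃ j, t j = 0) → B ω t = 0
  increments_law : ∀ a b : Fin q → I, a ≤ b →
    HasLaw (fun ω => alternatingSum (B ω) a b)
      (gaussianReal 0 (∏ j, Real.toNNReal ((b j : ℝ) - a j))) P
  increments_indep : ∀ (k : ℕ) (a b : Fin k → Fin q → I), (∀ i, a i ≤ b i) →
    Pairwise (fun i i' => Disjoint (block (a i) (b i)) (block (a i') (b i'))) →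
    iIndepFun (fun i ω => alternatingSum (B ω) (a i) (b i)) P

/-! ## The noise -/

/-- A zero-mean weakly stationary (square integrable) random field on `ℤ^3`. -/
structure IsCenteredWeaklyStationary {Ω : Type*} [MeasurableSpace Ω]
    (ε : (Fin 3 → ℤ) → Ω → ℝ) (P : Measure Ω) : Prop where
  memLp : ∀ i, MemLp (ε i) 2 P
  mean_zero : ∀ i, ∫ ω, ε i ω ∂P = 0
  cov_shift : ∀ i j h, cov[ε (i + h), ε (j + h); P] = cov[ε i, ε j; P]

/-- The index set `{1,…,m_1} × {1,…,m_2} × {1,…,m_3}`. -/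
def indexBox (m : Fin 3 → ℕ) : Finset (Fin 3 → ℤ) :=
  Fintype.piFinset fun j => Finset.Icc 1 (m j : ℤ)

/-- `Z_n(v) = (n_1 n_2 n_3)^{-1/2} ∑_{i_1 ≤ ⌊n_1 v_1⌋} ∑_{i_2 ≤ ⌊n_2 v_2⌋} ∑_{i_3 ≤ ⌊n_3 v_3⌋} e_i`
for a real array `e`. -/
def partialSum (e : (Fin 3 → ℤ) → ℝ) (n : Fin 3 → ℕ) (v : Fin 3 → I) : ℝ :=
  (√(∏ j, (n j : ℝ)))⁻¹ * ∑ i ∈ indexBox (fun j => ⌊(n j : ℝ) * v j⌋₊), e i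

theorem eventually_floor_right (m : ℕ) (x : I) :
    ∀ᶠ y : I in 𝓝 x, x ≤ y → ⌊(m : ℝ) * (y : ℝ)⌋₊ = ⌊(m : ℝ) * (x : ℝ)⌋₊ := by
  have hc : Continuous fun y : I => (m : ℝ) * (y : ℝ) := by fun_prop
  filter_upwards [hc.continuousAt.eventually_lt_const (Nat.lt_floor_add_one ((m : ℝ) * (x : ℝ)))]
    with y hy hxy
  have hxy' : (x : ℝ) ≤ y := hxy
  have hm : (m : ℝ) * x ≤ m * y := mul_le_mul_of_nonneg_left hxy' (Nat.cast_nonneg m)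
  have h0 : 0 ≤ (m : ℝ) * x := mul_nonneg (Nat.cast_nonneg m) x.2.1
  exact (Nat.floor_eq_iff (h0.trans hm)).2 ⟨(Nat.floor_le h0).trans hm, hy⟩

theorem eventually_floor_left (m : ℕ) (x : I) :
    ∀ᶠ y : I in 𝓝 x, y < x → ⌊(m : ℝ) * (y : ℝ)⌋₊ = ⌈(m : ℝ) * (x : ℝ)⌉₊ - 1 := by
  have hc : Continuous fun y : I => (m : ℝ) * (y : ℝ) := by fun_prop
  have h0 : 0 ≤ (m : ℝ) * x := mul_nonneg (Nat.cast_nonneg m) x.2.1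
  have h1 : (⌈(m : ℝ) * (x : ℝ)⌉₊ : ℝ) - 1 < (m : ℝ) * x := by
    linarith [Nat.ceil_lt_add_one h0]
  filter_upwards [hc.continuousAt.eventually_const_lt h1] with y hy hyx
  have hyx' : (y : ℝ) < x := hyx
  rcases Nat.eq_zero_or_pos m with rfl | hm
  · simp
  have hm' : (0 : ℝ) < m := Nat.cast_pos.2 hm
  have hlt : (m : ℝ) * y < m * x := mul_lt_mul_of_pos_left hyx' hm'
  have hy0 : 0 ≤ (m : ℝ) * y := mul_nonneg hm'.le y.2.1
  have hpos : 1 ≤ ⌈(m : ℝ) * (x : ℝ)⌉₊ := Nat.ceil_pos.2 (hy0.trans_lt hlt)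
  refine (Nat.floor_eq_iff hy0).2 ⟨?_, ?_⟩
  · rw [Nat.cast_sub hpos]
    simpa using hy.le
  · rw [Nat.cast_sub hpos]
    simpa using hlt.trans_le (Nat.le_ceil _)

theorem isSkorohod_partialSum (e : (Fin 3 → ℤ) → ℝ) (n : Fin 3 → ℕ) :
    IsSkorohod (partialSum e n) := by
  intro t
  have hproj : ∀ {p : I → Prop} (j : Fin 3), (∀ᶠ y in 𝓝 (t j), p y) →
      ∀ᶠ s : Fin 3 → I in 𝓝 t, p (s j) := fun j h =>
    (continuous_apply j).continuousAt.eventually h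
  have key : ∀ R : Finset (Fin 3), ∀ᶠ s in 𝓝[quadrant R t] t,
      (fun j => ⌊(n j : ℝ) * (s j : ℝ)⌋₊) = fun j =>
        if j ∈ R then ⌈(n j : ℝ) * (t j : ℝ)⌉₊ - 1 else ⌊(n j : ℝ) * (t j : ℝ)⌋₊ := by
    intro R
    have hl := eventually_all.2 fun j => hproj j (eventually_floor_left (n j) (t j))
    have hr := eventually_all.2 fun j => hproj j (eventually_floor_right (n j) (t j))
    filter_upwards [mem_nhdsWithin_of_mem_nhds hl, mem_nhdsWithin_of_mem_nhds hr,
      self_mem_nhdsWithin] with s h1 h2 h3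
    funext j
    have h3j := h3 j
    by_cases hj : j ∈ R
    · rw [if_pos hj] at h3j ⊢
      exact h1 j h3j
    · rw [if_neg hj] at h3j ⊢
      exact h2 j h3j
  refine ⟨fun R => ⟨(√(∏ j, (n j : ℝ)))⁻¹ * ∑ i ∈ indexBox (fun j =>
    if j ∈ R then ⌈(n j : ℝ) * (t j : ℝ)⌉₊ - 1 else ⌊(n j : ℝ) * (t j : ℝ)⌋₊), e i, ?_⟩, ?_⟩
  · refine tendsto_const_nhds.congr' ?_
    filter_upwards [key R] with s hs
    simp only [partialSum, hs]
  · refine tendsto_const_nhds.congr' ?_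
    filter_upwards [key ∅] with s hs
    simp only [partialSum, hs]
    simp

/-- The partial sum process `Z_n` as a map into the Skorohod space `D[0,1]^3`. -/
def partialSumProcess {Ω : Type*} (ε : (Fin 3 → ℤ) → Ω → ℝ) (n : Fin 3 → ℕ) (ω : Ω) :
    SkorohodSpace 3 :=
  ⟨partialSum (fun i => ε i ω) n, isSkorohod_partialSum _ n⟩

/-! ## The detection algorithm

A vector `n : Fin 3 → ℕ` holds the sample sizes, `τ j m` is the sampling period in direction `j`
for sample size `m`, and points `x : Fin 3 → ℝ` stand for `(t, r_2, r_3)`. -/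

/-- The product kernel `φ(x) = ∏ sin(b_j x_j) / (π x_j)`, with the value `b_j / π` of a
factor at `x_j = 0`; `b` is the vector of band widths. -/
def reconstructionKernel (b x : Fin 3 → ℝ) : ℝ :=
  ∏ j, if x j = 0 then b j / Real.pi else Real.sin (b j * x j) / (Real.pi * x j)

/-- The sampling point `(l_1 τ_1, l_2 τ_2, l_3 τ_3)`. -/
def samplePoint (τ : Fin 3 → ℕ → ℝ) (n : Fin 3 → ℕ) (l : Fin 3 → ℤ) : Fin 3 → ℝ :=
  fun j => l j * τ j (n j)

/-- The observations `y_l = f(l_1 τ_1, l_2 τ_2, l_3 τ_3) + ε_l`. -/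
def observation {Ω : Type*} (f : (Fin 3 → ℝ) → ℝ) (τ : Fin 3 → ℕ → ℝ)
    (ε : (Fin 3 → ℤ) → Ω → ℝ) (n : Fin 3 → ℕ) (ω : Ω) (l : Fin 3 → ℤ) : ℝ :=
  f (samplePoint τ n l) + ε l ω

/-- The detection process `F_n(s, x)` with reference signal `f₀`, computed from data `y`. -/
def detectionProc (b : Fin 3 → ℝ) (f₀ : (Fin 3 → ℝ) → ℝ) (τ : Fin 3 → ℕ → ℝ) (n : Fin 3 → ℕ)
    (y : (Fin 3 → ℤ) → ℝ) (s : ℝ) (x : Fin 3 → ℝ) : ℝ :=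
  √(∏ j, τ j (n j)) *
    ∑ l ∈ indexBox (Function.update n 0 ⌊(n 0 : ℝ) * s⌋₊),
      (y l - f₀ (samplePoint τ n l)) * reconstructionKernel b (x - samplePoint τ n l)

/-- The points `x = (t, r_2, r_3)` with `0 ≤ t ≤ s T_1`, `0 ≤ r_2 ≤ T_2` and `0 ≤ r_3 ≤ T_3`. -/
def monitoringRegion (T : Fin 3 → ℝ) (s : ℝ) : Set (Fin 3 → ℝ) :=
  {x | (0 ≤ x 0 ∧ x 0 ≤ s * T 0) ∧ (0 ≤ x 1 ∧ x 1 ≤ T 1) ∧ (0 ≤ x 2 ∧ x 2 ≤ T 2)}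

/-- The global maximum norm detector `M_n`: the least `k` with `⌊n_1 s₀⌋ ≤ k ≤ n_1` for which the
maximum of `|F_n(k/n_1, ·)|` over `monitoringRegion T (k/n_1)` exceeds `c`, and `∞` if there is no
such `k`. -/
def globalDetector (b : Fin 3 → ℝ) (f₀ : (Fin 3 → ℝ) → ℝ) (τ : Fin 3 → ℕ → ℝ) (T : Fin 3 → ℝ)
    (s₀ c : ℝ) (n : Fin 3 → ℕ) (y : (Fin 3 → ℤ) → ℝ) : ℕ∞ :=
  ⨅ k ∈ {k : ℕ | ⌊(n 0 : ℝ) * s₀⌋₊ ≤ k ∧ k ≤ n 0 ∧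
    ENNReal.ofReal c < ⨆ x ∈ monitoringRegion T ((k : ℝ) / n 0),
      ‖detectionProc b f₀ τ n y ((k : ℝ) / n 0) x‖ₑ}, (k : ℕ∞)

/-! ## The limit process -/

/-- The covariance function of the limit process at `(s, x)` and `(s', x')`. -/
def limitCov (b : Fin 3 → ℝ) (T : Fin 3 → ℝ) (sig : ℝ) (s : ℝ) (x : Fin 3 → ℝ)
    (s' : ℝ) (x' : Fin 3 → ℝ) : ℝ :=
  sig ^ 2 * (∏ j, T j) * ∫ z₁ in (0 : ℝ)..min s s', ∫ z₂ in (0 : ℝ)..1, ∫ z₃ in (0 : ℝ)..1,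
    reconstructionKernel b (x - T * ![z₁, z₂, z₃]) *
      reconstructionKernel b (x' - T * ![z₁, z₂, z₃])

/-- `F` is a zero-mean Gaussian process on `[s₀,1] × [0,T_1] × [0,T_2] × [0,T_3]` with covariance
function `limitCov` and almost surely continuous sample paths. Values of `F` outside this domain are
irrelevant. -/
structure IsLimitProcess (b T : Fin 3 → ℝ) (sig s₀ : ℝ) {Ω : Type*} [MeasurableSpace Ω]
    (F : ℝ → (Fin 3 → ℝ) → Ω → ℝ) (P : Measure Ω) : Prop where
  gaussian : IsGaussianProcess
    (fun p : (Set.Icc s₀ 1 ×ˢ Set.Icc 0 T : Set (ℝ × (Fin 3 → ℝ))) => F p.1.1 p.1.2) P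
  mean_zero : ∀ s ∈ Set.Icc s₀ 1, ∀ x ∈ Set.Icc 0 T, ∫ ω, F s x ω ∂P = 0
  covariance : ∀ s ∈ Set.Icc s₀ 1, ∀ x ∈ Set.Icc 0 T, ∀ s' ∈ Set.Icc s₀ 1, ∀ x' ∈ Set.Icc 0 T,
    cov[F s x, F s' x'; P] = limitCov b T sig s x s' x'
  continuous_paths : ∀ᵐ ω ∂P,
    ContinuousOn (fun p : ℝ × (Fin 3 → ℝ) => F p.1 p.2 ω) (Set.Icc s₀ 1 ×ˢ Set.Icc 0 T)

end

noncomputable section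

/-! ## Increments around blocks -/

/-! Under the null hypothesis the signal cancels, and the detection process at time `k / n 0` is a
linear functional `gridSum` of the increments of the partial sum process over the cells of the grid
(`detectionProc_eq_gridSum`). The proof treats `gridSum` as a deterministic functional of a function
`w` on the cube, shows that it converges at continuous `w`, and transfers this to the random setting
by a continuous mapping argument.

Deterministic part. The kernel is a product of bounded Lipschitz factors, so summation by parts
bounds `gridSum` by a constant times the supremum of `|w|`, uniformly in the sample sizes, in `k`
and in `x` (`exists_abs_gridSum_le`). For monomials `w` the functional factors into one-dimensional
Riemann-Stieltjes sums, which converge uniformly in `k` and `x` (`isGridLimit_monomial`).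
Stone-Weierstrass and the uniform bound extend the convergence to every continuous `w`
(`exists_isGridLimit`); the limit is `limitFunctional`.

Limit process. Applied to scaled Brownian motion, `gridSum` is a linear combination of independent
normal increments, and its covariances are Riemann sums for `limitCov`. Almost sure limits of such
combinations stay Gaussian, so `limitFunctional` of the scaled Brownian motion is a limit process
(`IsBrownianSheet.isLimitProcess`). Any other limit process has the same law on a countable dense
set of monitored points, which determines the law of the supremum
(`IsLimitProcess.measure_lt_iSup`).

Convergence of probabilities. The events depend on `n`, so the closed-set half of the portmanteau
theorem is applied to the closed sets `tailClosure` (`tendsto_measure_preimage`). Near a continuous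
function the Skorohod distance controls the uniform one; hence a continuous path in all tail
closures of the exceedance sets has supremum at least `c`, and one in all tail closures of the
complements has supremum at most `c`. The two conclusions match because the supremum has no atom at
`c` (`IsLimitProcess.measure_iSup_eq_zero`): locally the process is a positive multiple of one fixed
nondegenerate normal variable plus an independent part, so the supremum is strictly increasing in
that variable. -/

/-- The alternating sum over the vertices of a block, for an arbitrary coordinate type. -/
def boxIncrement {α : Type*} {q : ℕ} (f : (Fin q → α) → ℝ) (a b : Fin q → α) : ℝ :=
  ∑ v : Finset (Fin q), (-1) ^ v.card * f (v.piecewise a b)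

theorem alternatingSum_eq_boxIncrement {q : ℕ} (f : (Fin q → I) → ℝ) (a b : Fin q → I) :
    alternatingSum f a b = boxIncrement f a b := rfl

/-- Expanding the product of differences over subsets gives the alternating sum; the subset `v`
records the coordinates in which the lower corner is chosen. -/
theorem boxIncrement_prod {α : Type*} {q : ℕ} (h : Fin q → α → ℝ) (a b : Fin q → α) :
    boxIncrement (fun v => ∏ j, h j (v j)) a b = ∏ j, (h j (b j) - h j (a j)) := by
  classical
  have := Finset.prod_add (fun j => - h j (a j)) (fun j => h j (b j)) Finset.univ
  simp only [neg_add_eq_sub] at this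
  rw [this, Finset.powerset_univ]
  refine Finset.sum_congr rfl fun v _ => ?_
  rw [Finset.prod_neg, mul_assoc]
  congr 1
  change ∏ j, h j (v.piecewise a b j) = _
  rw [← Finset.prod_mul_prod_compl v, Finset.compl_eq_univ_sdiff]
  congr 1
  · exact Finset.prod_congr rfl fun j hj => by simp [hj]
  · exact Finset.prod_congr rfl fun j hj => by
      simp only [Finset.mem_sdiff, Finset.mem_univ, true_and] at hj
      simp [hj]

theorem boxIncrement_sum {α ι : Type*} {q : ℕ} (s : Finset ι) (f : ι → (Fin q → α) → ℝ)
    (a b : Fin q → α) :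
    boxIncrement (fun v => ∑ i ∈ s, f i v) a b = ∑ i ∈ s, boxIncrement (f i) a b := by
  simp only [boxIncrement, Finset.mul_sum]
  exact Finset.sum_comm

theorem boxIncrement_const_mul {α : Type*} {q : ℕ} (c : ℝ) (f : (Fin q → α) → ℝ)
    (a b : Fin q → α) :
    boxIncrement (fun v => c * f v) a b = c * boxIncrement f a b := by
  simp only [boxIncrement, Finset.mul_sum]
  exact Finset.sum_congr rfl fun _ _ => by ring

theorem boxIncrement_add {α : Type*} {q : ℕ} (f g : (Fin q → α) → ℝ) (a b : Fin q → α) :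
    boxIncrement (fun v => f v + g v) a b = boxIncrement f a b + boxIncrement g a b := by
  simp only [boxIncrement, mul_add, Finset.sum_add_distrib]

theorem boxIncrement_sub {α : Type*} {q : ℕ} (f g : (Fin q → α) → ℝ) (a b : Fin q → α) :
    boxIncrement (fun v => f v - g v) a b = boxIncrement f a b - boxIncrement g a b := by
  simp only [boxIncrement, mul_sub, Finset.sum_sub_distrib]

/-- This lets an increment over a grid cell of the cube be read as an increment over a unit cell of
the integer lattice, where summation by parts takes place. -/
theorem boxIncrement_comp {α β : Type*} {q : ℕ} (f : (Fin q → β) → ℝ) (g : Fin q → α → β)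
    (a b : Fin q → α) :
    boxIncrement f (fun j => g j (a j)) (fun j => g j (b j)) =
      boxIncrement (fun v => f fun j => g j (v j)) a b := by
  classical
  refine Finset.sum_congr rfl fun v _ => ?_
  congr 2
  ext j
  by_cases hj : j ∈ v <;> simp [hj]

/-- One-dimensional variation estimate behind the summation by parts. -/
theorem sum_abs_weight_le {m : ℕ} {g : ℤ → ℝ} {M κ : ℝ} (hM : ∀ i, |g i| ≤ M)
    (hκ : ∀ i, |g i - g (i + 1)| ≤ κ) :
    ∑ i ∈ Finset.Icc (0 : ℤ) m, |∑ l ∈ Finset.Icc (1 : ℤ) m,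
      g l * ((if l = i then 1 else 0) - (if l - 1 = i then 1 else 0))| ≤
      2 * M + (m + 1) * κ := by
  have hM0 : 0 ≤ M := (abs_nonneg _).trans (hM 0)
  have hκ0 : 0 ≤ κ := (abs_nonneg _).trans (hκ 0)
  -- An interior `i` receives `g i - g (i + 1)`, at most `κ`; only `i = 0` and `i = m` can leave an
  -- unpaired boundary value, at most `M`.
  have key : ∀ i ∈ Finset.Icc (0 : ℤ) m, |∑ l ∈ Finset.Icc (1 : ℤ) m,
      g l * ((if l = i then 1 else 0) - (if l - 1 = i then 1 else 0))| ≤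
      κ + ((if 0 = i then M else 0) + (if (m : ℤ) = i then M else 0)) := by
    intro i hi
    rw [Finset.mem_Icc] at hi
    have h1 : ∑ l ∈ Finset.Icc (1 : ℤ) m,
        g l * ((if l = i then 1 else 0) - (if l - 1 = i then 1 else 0)) =
        (if 1 ≤ i then g i else 0) - (if i < m then g (i + 1) else 0) := by
      have hsub : ∀ l : ℤ, l - 1 = i ↔ l = i + 1 := fun l => by omega
      simp only [mul_sub, Finset.sum_sub_distrib, mul_ite, mul_one, mul_zero, hsub,
        Finset.sum_ite_eq', Finset.mem_Icc]
      congr 1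
      · simp [hi.2]
      · simp only [Int.add_one_le_iff]
        simp [hi.1]
    rw [h1]
    have hMi := hM i
    have hMi1 := hM (i + 1)
    have hki := hκ i
    by_cases h0 : 0 = i
    · have : ¬ (1 ≤ i) := by omega
      rw [if_neg this, if_pos h0]
      have h3 : (0 : ℝ) ≤ if (m : ℤ) = i then M else 0 := by split_ifs <;> simp [hM0]
      split_ifs at h3 ⊢ <;> simp <;> linarith
    · have h2 : 1 ≤ i := by omega
      rw [if_pos h2, if_neg h0]
      by_cases hm : (m : ℤ) = i
      · have : ¬ (i < m) := by omega
        rw [if_neg this, if_pos hm]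
        simp
        linarith
      · have : i < m := by omega
        rw [if_pos this, if_neg hm]
        simpa using hki
  refine (Finset.sum_le_sum key).trans ?_
  rw [Finset.sum_add_distrib, Finset.sum_add_distrib, Finset.sum_ite_eq, Finset.sum_ite_eq]
  simp
  linarith

/-- Summation by parts: weighted sums of block increments are bounded by the supremum of the
function. -/
theorem abs_sum_prod_mul_boxIncrement_le (m : Fin 3 → ℕ) (g : Fin 3 → ℤ → ℝ) (M κ : Fin 3 → ℝ)
    (hM : ∀ j i, |g j i| ≤ M j) (hκ : ∀ j i, |g j i - g j (i + 1)| ≤ κ j)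
    (W : (Fin 3 → ℤ) → ℝ) (C : ℝ) (hW : ∀ i, |W i| ≤ C) :
    |∑ l ∈ indexBox m, (∏ j, g j (l j)) * boxIncrement W (l - 1) l| ≤
      C * ∏ j, (2 * M j + (m j + 1) * κ j) := by
  classical
  have hC : 0 ≤ C := (abs_nonneg _).trans (hW 0)
  set A : Finset (Fin 3 → ℤ) := Fintype.piFinset fun j => Finset.Icc (0 : ℤ) (m j) with hA
  -- Writing the cell increment through Kronecker deltas separates the coordinates, so that the sums
  -- over `l` and `i` can be exchanged and the differences fall on the weights.
  have hdec : ∀ l ∈ indexBox m, boxIncrement W (l - 1) l =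
      ∑ i ∈ A, W i * ∏ j, ((if l j = i j then (1 : ℝ) else 0) -
        (if l j - 1 = i j then 1 else 0)) := by
    intro l hl
    have hl' : ∀ j, 1 ≤ l j ∧ l j ≤ m j := by
      simpa [indexBox, Fintype.mem_piFinset] using hl
    have h1 : ∀ i ∈ A, W i * ∏ j, ((if l j = i j then (1 : ℝ) else 0) -
        (if l j - 1 = i j then 1 else 0)) =
        boxIncrement (fun v => W i * ∏ j, (if v j = i j then (1 : ℝ) else 0)) (l - 1) l := by
      intro i _
      rw [boxIncrement_const_mul,
        boxIncrement_prod (fun j (y : ℤ) => if y = i j then (1 : ℝ) else 0)]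
      rfl
    rw [Finset.sum_congr rfl h1, ← boxIncrement_sum]
    refine Finset.sum_congr rfl fun v _ => ?_
    congr 1
    have hmem : v.piecewise (l - 1) l ∈ A := by
      rw [hA, Fintype.mem_piFinset]
      intro j
      have := hl' j
      by_cases hj : j ∈ v <;> simp [hj] <;> omega
    have h2 : ∀ i : Fin 3 → ℤ, W i * ∏ j, (if (v.piecewise (l - 1) l) j = i j then (1 : ℝ) else 0) =
        if v.piecewise (l - 1) l = i then W i else 0 := by
      intro i
      rw [Finset.prod_ite_zero]
      simp [funext_iff]
    simp only [h2]
    rw [Finset.sum_ite_eq, if_pos hmem]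
  have hsum : ∑ l ∈ indexBox m, (∏ j, g j (l j)) * boxIncrement W (l - 1) l =
      ∑ i ∈ A, W i * ∏ j, ∑ l ∈ Finset.Icc (1 : ℤ) (m j),
        g j l * ((if l = i j then 1 else 0) - (if l - 1 = i j then 1 else 0)) := by
    rw [Finset.sum_congr rfl fun l hl => by rw [hdec l hl]]
    simp only [Finset.mul_sum]
    rw [Finset.sum_comm]
    refine Finset.sum_congr rfl fun i _ => ?_
    rw [Finset.prod_univ_sum, Finset.mul_sum]
    refine Finset.sum_congr rfl fun l _ => ?_
    rw [Finset.prod_mul_distrib]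
    ring
  rw [hsum]
  calc |∑ i ∈ A, W i * ∏ j, ∑ l ∈ Finset.Icc (1 : ℤ) (m j),
        g j l * ((if l = i j then 1 else 0) - (if l - 1 = i j then 1 else 0))|
      ≤ ∑ i ∈ A, C * ∏ j, |∑ l ∈ Finset.Icc (1 : ℤ) (m j),
        g j l * ((if l = i j then 1 else 0) - (if l - 1 = i j then 1 else 0))| := by
        refine (Finset.abs_sum_le_sum_abs _ _).trans (Finset.sum_le_sum fun i _ => ?_)
        rw [abs_mul, Finset.abs_prod]
        exact mul_le_mul_of_nonneg_right (hW i) (Finset.prod_nonneg fun _ _ => abs_nonneg _)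
    _ = C * ∏ j, ∑ i ∈ Finset.Icc (0 : ℤ) (m j), |∑ l ∈ Finset.Icc (1 : ℤ) (m j),
        g j l * ((if l = i then 1 else 0) - (if l - 1 = i then 1 else 0))| := by
        rw [← Finset.mul_sum, Finset.prod_univ_sum]
    _ ≤ _ := by
        refine mul_le_mul_of_nonneg_left (Finset.prod_le_prod (fun _ _ => Finset.sum_nonneg
          fun _ _ => abs_nonneg _) fun j _ => sum_abs_weight_le (hM j) (hκ j)) hC

/-! ## The grid and the detection process as a functional of the partial sum process -/

/-- The point `(l_j / n_j)_j` of the grid, projected to the cube. -/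
def gridPoint (n : Fin 3 → ℕ) (l : Fin 3 → ℤ) : Fin 3 → I :=
  fun j => Set.projIcc 0 1 zero_le_one ((l j : ℝ) / n j)

theorem coe_projIcc_div {m : ℕ} {i : ℤ} (h0 : 0 ≤ i) (hm : i ≤ m) :
    ((Set.projIcc (0 : ℝ) 1 zero_le_one ((i : ℝ) / m) : I) : ℝ) = i / m := by
  have h0' : (0 : ℝ) ≤ i := by exact_mod_cast h0
  have hm' : (i : ℝ) ≤ m := by exact_mod_cast hm
  rw [Set.projIcc_of_mem zero_le_one (⟨by positivity, div_le_one_of_le₀ hm' (by positivity)⟩)]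

theorem floor_mul_projIcc_div {m : ℕ} (hm0 : 0 < m) {i : ℤ} (h0 : 0 ≤ i) (hm : i ≤ m) :
    (⌊(m : ℝ) * (Set.projIcc (0 : ℝ) 1 zero_le_one ((i : ℝ) / m) : I)⌋₊ : ℤ) = i := by
  rw [coe_projIcc_div h0 hm, mul_div_cancel₀ _ (by positivity)]
  lift i to ℕ using h0
  simp

/-- The index set no longer depends on `v`, and each summand is a product over coordinates, so
`boxIncrement_prod` applies termwise. -/
theorem partialSum_eq_sum_indicator (e : (Fin 3 → ℤ) → ℝ) (n : Fin 3 → ℕ) (v : Fin 3 → I) :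
    partialSum e n v = ∑ i ∈ indexBox n, ((√(∏ j, (n j : ℝ)))⁻¹ * e i) *
      ∏ j, (if i j ≤ (⌊(n j : ℝ) * v j⌋₊ : ℤ) then (1 : ℝ) else 0) := by
  classical
  have hfl : ∀ j, ⌊(n j : ℝ) * v j⌋₊ ≤ n j := fun j => by
    refine Nat.floor_le_of_le ?_
    exact mul_le_of_le_one_right (Nat.cast_nonneg _) (v j).2.2
  simp only [Finset.prod_ite_zero, Finset.prod_const_one, mul_ite, mul_one, mul_zero]
  rw [← Finset.sum_filter, partialSum, Finset.mul_sum]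
  refine Finset.sum_congr ?_ fun _ _ => rfl
  ext i
  simp only [indexBox, Fintype.mem_piFinset, Finset.mem_Icc, Finset.mem_filter, Finset.mem_univ,
    true_imp_iff]
  constructor
  · intro h
    exact ⟨fun j => ⟨(h j).1, (h j).2.trans (by exact_mod_cast hfl j)⟩, fun j => (h j).2⟩
  · exact fun h j => ⟨(h.1 j).1, h.2 j⟩

/-- In each coordinate the indicator of `i j ≤ ·` jumps between `l j - 1` and `l j` exactly when `i
j = l j`; the cell therefore isolates a single noise variable. -/
theorem boxIncrement_partialSum (e : (Fin 3 → ℤ) → ℝ) (n : Fin 3 → ℕ) (hn : ∀ j, 0 < n j)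
    (l : Fin 3 → ℤ) (hl : l ∈ indexBox n) :
    boxIncrement (partialSum e n) (gridPoint n (l - 1)) (gridPoint n l) =
      (√(∏ j, (n j : ℝ)))⁻¹ * e l := by
  classical
  have hl' : ∀ j, 1 ≤ l j ∧ l j ≤ n j := by simpa [indexBox, Fintype.mem_piFinset] using hl
  have h1 : partialSum e n = fun v => ∑ i ∈ indexBox n, ((√(∏ j, (n j : ℝ)))⁻¹ * e i) *
      ∏ j, (if i j ≤ (⌊(n j : ℝ) * v j⌋₊ : ℤ) then (1 : ℝ) else 0) :=
    funext fun v => partialSum_eq_sum_indicator e n v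
  rw [h1, boxIncrement_sum]
  have h2 : ∀ i ∈ indexBox n, boxIncrement (fun v : Fin 3 → I => ((√(∏ j, (n j : ℝ)))⁻¹ * e i) *
      ∏ j, (if i j ≤ (⌊(n j : ℝ) * v j⌋₊ : ℤ) then (1 : ℝ) else 0)) (gridPoint n (l - 1))
      (gridPoint n l) = if l = i then (√(∏ j, (n j : ℝ)))⁻¹ * e i else 0 := by
    intro i _
    rw [boxIncrement_const_mul, boxIncrement_prod
      (fun j (y : I) => if i j ≤ (⌊(n j : ℝ) * y⌋₊ : ℤ) then (1 : ℝ) else 0)]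
    have h3 : ∀ j, ((if i j ≤ (⌊(n j : ℝ) * (gridPoint n l j : I)⌋₊ : ℤ) then (1 : ℝ) else 0) -
        if i j ≤ (⌊(n j : ℝ) * (gridPoint n (l - 1) j : I)⌋₊ : ℤ) then (1 : ℝ) else 0) =
        if l j = i j then 1 else 0 := by
      intro j
      have := hl' j
      rw [gridPoint, gridPoint, floor_mul_projIcc_div (hn j) (by omega) (by omega),
        floor_mul_projIcc_div (hn j) (by simp; omega) (by simp; omega)]
      simp only [Pi.sub_apply, Pi.one_apply]
      split_ifs <;> first | omega | simp
    simp only [h3]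
    rw [Finset.prod_ite_zero]
    simp [funext_iff]
  rw [Finset.sum_congr rfl h2, Finset.sum_ite_eq, if_pos hl]

/-- The detection process as a functional of a function `w` on the cube, whose increments around
the cells of the grid play the role of the normalised noise. -/
def gridSum (b : Fin 3 → ℝ) (τ : Fin 3 → ℕ → ℝ) (n : Fin 3 → ℕ) (w : (Fin 3 → I) → ℝ) (k : ℕ)
    (x : Fin 3 → ℝ) : ℝ :=
  √(∏ j, (n j * τ j (n j))) * ∑ l ∈ indexBox (Function.update n 0 k),
    reconstructionKernel b (x - samplePoint τ n l) *
      boxIncrement w (gridPoint n (l - 1)) (gridPoint n l)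

theorem indexBox_update_subset {n : Fin 3 → ℕ} {k : ℕ} (hk : k ≤ n 0) :
    indexBox (Function.update n 0 k) ⊆ indexBox n := by
  refine Fintype.piFinset_subset _ _ fun j => Finset.Icc_subset_Icc le_rfl ?_
  rcases eq_or_ne j 0 with rfl | hj
  · simpa using hk
  · simp [hj]

/-- The null hypothesis leaves only noise, and the normalisation of the partial sums is absorbed by
replacing `τ j (n j)` with `n j * τ j (n j)` under the root. -/
theorem detectionProc_eq_gridSum {Ω : Type*} (b : Fin 3 → ℝ) (τ : Fin 3 → ℕ → ℝ)
    (f f₀ : (Fin 3 → ℝ) → ℝ)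
    (hf : ∀ n, ∀ l ∈ indexBox n, f (samplePoint τ n l) = f₀ (samplePoint τ n l))
    (ε : (Fin 3 → ℤ) → Ω → ℝ) (n : Fin 3 → ℕ) (hn : ∀ j, 0 < n j) (ω : Ω) (k : ℕ) (hk : k ≤ n 0)
    (x : Fin 3 → ℝ) :
    detectionProc b f₀ τ n (observation f τ ε n ω) ((k : ℝ) / n 0) x =
      gridSum b τ n (partialSum (fun i => ε i ω) n) k x := by
  have hn0 : (n 0 : ℝ) ≠ 0 := by exact_mod_cast (hn 0).ne'
  have hpos : 0 < √(∏ j, (n j : ℝ)) :=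
    Real.sqrt_pos.2 (Finset.prod_pos fun j _ => by exact_mod_cast hn j)
  rw [detectionProc, gridSum, mul_div_cancel₀ _ hn0, Nat.floor_natCast, Finset.prod_mul_distrib,
    Real.sqrt_mul (Finset.prod_nonneg fun _ _ => Nat.cast_nonneg _), mul_comm (√_) (√_), mul_assoc,
    Finset.mul_sum (a := √(∏ j, (n j : ℝ)))]
  congr 1
  refine Finset.sum_congr rfl fun l hl => ?_
  have hl' := indexBox_update_subset hk hl
  rw [boxIncrement_partialSum _ n hn l hl', observation, hf n l hl']
  field_simp
  ring

/-! ## The one-dimensional kernel -/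

theorem sinc_eq_integral_cos (x : ℝ) : Real.sinc x = ∫ t in (0 : ℝ)..1, Real.cos (x * t) := by
  rcases eq_or_ne x 0 with rfl | hx
  · simp
  · rw [intervalIntegral.integral_comp_mul_left (fun u => Real.cos u) hx]
    simp [Real.sinc_of_ne_zero hx, div_eq_inv_mul]

/-- `sinc` is an average of the functions `cos (x * t)` with `t` in the unit interval, each of which
is 1-Lipschitz in `x`. -/
theorem abs_sinc_sub_sinc_le (x y : ℝ) : |Real.sinc x - Real.sinc y| ≤ |x - y| := by
  rw [sinc_eq_integral_cos, sinc_eq_integral_cos, ← intervalIntegral.integral_sub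
    (Continuous.intervalIntegrable (by fun_prop) _ _)
    (Continuous.intervalIntegrable (by fun_prop) _ _)]
  have h := intervalIntegral.norm_integral_le_of_norm_le_const (a := (0 : ℝ)) (b := 1)
    (f := fun t => Real.cos (x * t) - Real.cos (y * t)) (C := |x - y|) ?_
  · simpa using h
  · intro t ht
    rw [Set.uIoc_of_le zero_le_one] at ht
    have h1 := Real.lipschitzWith_cos.dist_le_mul (x * t) (y * t)
    rw [Real.dist_eq, Real.dist_eq, ← sub_mul, abs_mul, abs_of_pos ht.1] at h1
    rw [Real.norm_eq_abs]
    refine h1.trans ?_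
    simp only [NNReal.coe_one, one_mul]
    exact mul_le_of_le_one_right (abs_nonneg _) ht.2

/-- One factor of the reconstruction kernel. -/
def sincKernel (b y : ℝ) : ℝ := b / Real.pi * Real.sinc (b * y)

theorem reconstructionKernel_eq_prod (b x : Fin 3 → ℝ) :
    reconstructionKernel b x = ∏ j, sincKernel (b j) (x j) := by
  refine Finset.prod_congr rfl fun j _ => ?_
  rw [sincKernel]
  split_ifs with h
  · simp [h]
  · rcases eq_or_ne (b j) 0 with hb | hb
    · simp [hb]
    · rw [Real.sinc_of_ne_zero (mul_ne_zero hb h)]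
      field_simp

@[fun_prop]
theorem continuous_sincKernel (b : ℝ) : Continuous (sincKernel b) := by
  unfold sincKernel
  fun_prop

theorem abs_sincKernel_le (b y : ℝ) : |sincKernel b y| ≤ |b| / Real.pi := by
  rw [sincKernel, abs_mul, abs_div, abs_of_pos Real.pi_pos]
  exact mul_le_of_le_one_right (by positivity) (Real.abs_sinc_le_one _)

theorem abs_sincKernel_sub_le (b x y : ℝ) :
    |sincKernel b x - sincKernel b y| ≤ |b| / Real.pi * |b| * |x - y| := by
  rw [sincKernel, sincKernel, ← mul_sub, abs_mul, abs_div, abs_of_pos Real.pi_pos, mul_assoc]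
  refine mul_le_mul_of_nonneg_left ?_ (by positivity)
  rw [← abs_mul, mul_sub]
  exact abs_sinc_sub_sinc_le _ _

theorem sincKernel_zero (b : ℝ) : sincKernel b 0 = b / Real.pi := by simp [sincKernel]

/-! ## Riemann-Stieltjes sums -/

theorem sum_Icc_one_eq_sum_range (k : ℕ) (f : ℤ → ℝ) :
    ∑ l ∈ Finset.Icc (1 : ℤ) k, f l = ∑ i ∈ Finset.range k, f (i + 1) := by
  refine (Finset.sum_bij (fun (i : ℕ) _ => (i : ℤ) + 1) ?_ ?_ ?_ fun _ _ => rfl).symm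
  · intro i hi
    simp only [Finset.mem_range, Finset.mem_Icc] at *
    omega
  · intro i _ j _ h
    omega
  · intro l hl
    rw [Finset.mem_Icc] at hl
    exact ⟨(l - 1).toNat, by simp; omega, by omega⟩

/-- Quantitative convergence of Riemann-Stieltjes sums of a Lipschitz function against a
continuously differentiable one. -/
theorem abs_riemannStieltjes_sub_integral_le {g : ℝ → ℝ} {κ : ℝ}
    (hg : ∀ y y', |g y - g y'| ≤ κ * |y - y'|) {p p' : ℝ → ℝ} (hp : ∀ v, HasDerivAt p (p' v) v)
    (hp' : Continuous p') {D : ℝ} (hD : ∀ v ∈ Set.Icc (0 : ℝ) 1, |p' v| ≤ D) {m k : ℕ} (hm : 0 < m)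
    (hk : k ≤ m) (t : ℝ) {T : ℝ} (hT : 0 ≤ T) :
    |∑ l ∈ Finset.Icc (1 : ℤ) k, g (l * t) * (p (l / m) - p ((l - 1) / m)) -
      ∫ v in (0 : ℝ)..(k / m), g (T * v) * p' v| ≤ κ * (|m * t - T| + T / m) * D := by
  have hm' : (0 : ℝ) < m := by exact_mod_cast hm
  have hD0 : 0 ≤ D := (abs_nonneg _).trans (hD 0 (by simp))
  have hκ0 : 0 ≤ κ := by
    have := (abs_nonneg _).trans (hg 0 1)
    simpa using this
  have hgc : Continuous g := by
    have : LipschitzWith ⟨κ, hκ0⟩ g := LipschitzWith.of_dist_le_mul fun x y => by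
      rw [Real.dist_eq, Real.dist_eq]
      exact hg x y
    exact this.continuous
  have hint : ∀ a b : ℝ, IntervalIntegrable (fun v => g (T * v) * p' v) volume a b :=
    fun a b => Continuous.intervalIntegrable (by fun_prop) _ _
  have hsum : ∫ v in (0 : ℝ)..(k / m), g (T * v) * p' v =
      ∑ i ∈ Finset.range k, ∫ v in ((i : ℕ) / m : ℝ)..((i + 1 : ℕ) / m : ℝ), g (T * v) * p' v := by
    rw [intervalIntegral.sum_integral_adjacent_intervals (a := fun i : ℕ => (i : ℝ) / m)
      (fun _ _ => hint _ _)]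
    simp
  rw [sum_Icc_one_eq_sum_range, hsum, ← Finset.sum_sub_distrib]
  -- Each of the at most `m` cells carries a `1 / m` share of the total error.
  have hterm : ∀ i ∈ Finset.range k, |g (((i : ℤ) + 1 : ℤ) * t) *
      (p (((i : ℤ) + 1 : ℤ) / m) - p ((((i : ℤ) + 1 : ℤ) - 1) / m)) -
      ∫ v in ((i : ℕ) / m : ℝ)..((i + 1 : ℕ) / m : ℝ), g (T * v) * p' v| ≤
      κ * (|m * t - T| + T / m) * D * (1 / m) := by
    intro i hi
    rw [Finset.mem_range] at hi
    have hi1 : ((i : ℝ) + 1) ≤ m := by exact_mod_cast (by omega : i + 1 ≤ m)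
    have hle : ((i : ℕ) / m : ℝ) ≤ ((i + 1 : ℕ) / m : ℝ) := by
      push_cast
      gcongr
      linarith
    have hftc : p (((i : ℤ) + 1 : ℤ) / m) - p ((((i : ℤ) + 1 : ℤ) - 1) / m) =
        ∫ v in ((i : ℕ) / m : ℝ)..((i + 1 : ℕ) / m : ℝ), p' v := by
      rw [intervalIntegral.integral_eq_sub_of_hasDerivAt (fun v _ => hp v)
        (hp'.intervalIntegrable _ _)]
      push_cast
      simp
    rw [hftc, ← intervalIntegral.integral_const_mul, ← intervalIntegral.integral_sub
      (Continuous.intervalIntegrable (by fun_prop) _ _) (hint _ _)]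
    have hlen : |((i + 1 : ℕ) / m : ℝ) - ((i : ℕ) / m : ℝ)| = 1 / m := by
      rw [← sub_div]
      push_cast
      rw [add_sub_cancel_left, abs_of_pos (by positivity)]
    rw [← hlen, ← Real.norm_eq_abs]
    refine intervalIntegral.norm_integral_le_of_norm_le_const fun v hv => ?_
    rw [Set.uIoc_of_le hle] at hv
    obtain ⟨hv1, hv2⟩ := hv
    push_cast at hv2 ⊢
    have hv0 : (0 : ℝ) ≤ v := (by positivity : (0 : ℝ) ≤ (i : ℝ) / m).trans hv1.le
    have hv3 : v ≤ 1 := hv2.trans (div_le_one_of_le₀ hi1 hm'.le)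
    rw [← sub_mul, Real.norm_eq_abs, abs_mul]
    refine mul_le_mul ((hg _ _).trans ?_) (hD v ⟨hv0, hv3⟩) (abs_nonneg _) (by positivity)
    refine mul_le_mul_of_nonneg_left ?_ hκ0
    -- The sample point misses `T * v` for two reasons: `m * t` is only close to `T`, and `v` ranges
    -- over a cell of length `1 / m`.
    have hdec : ((i : ℝ) + 1) * t - T * v =
        (((i : ℝ) + 1) / m) * (m * t - T) + T * (((i : ℝ) + 1) / m - v) := by
      field_simp
      ring
    rw [hdec]
    refine (abs_add_le _ _).trans (add_le_add ?_ ?_)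
    · rw [abs_mul]
      refine mul_le_of_le_one_left (abs_nonneg _) ?_
      rw [abs_of_nonneg (by positivity)]
      exact div_le_one_of_le₀ hi1 hm'.le
    · rw [abs_mul, abs_of_nonneg hT, div_eq_mul_one_div T]
      refine mul_le_mul_of_nonneg_left ?_ hT
      have hsplit : ((i : ℝ) + 1) / m = i / m + 1 / m := add_div _ _ _
      rw [abs_of_nonneg (by linarith)]
      linarith
  refine (Finset.abs_sum_le_sum_abs _ _).trans ((Finset.sum_le_sum hterm).trans ?_)
  rw [Finset.sum_const, Finset.card_range, nsmul_eq_mul]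
  have hkm : (k : ℝ) / m ≤ 1 := div_le_one_of_le₀ (by exact_mod_cast hk) hm'.le
  calc (k : ℝ) * (κ * (|m * t - T| + T / m) * D * (1 / m))
      = (k : ℝ) / m * (κ * (|m * t - T| + T / m) * D) := by ring
    _ ≤ _ := mul_le_of_le_one_left (by positivity) hkm

/-! ## Uniform limits of the functionals -/

theorem tendsto_eval_atTop_nat (j : Fin 3) :
    Tendsto (fun n : Fin 3 → ℕ => n j) atTop atTop :=
  tendsto_atTop.2 fun c => (eventually_ge_atTop (fun _ => c)).mono fun _ hn => hn j

theorem eventually_forall_pos : ∀ᶠ n : Fin 3 → ℕ in atTop, ∀ j, 0 < n j :=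
  eventually_all.2 fun j => (tendsto_eval_atTop_nat j).eventually (eventually_gt_atTop 0)

/-- The filter of triples `(n, k, x)` with `k ≤ n 0` and `x ∈ [0, T]` as `n → ∞`, uniformly in `k`
and `x`. -/
def monitoringFilter (T : Fin 3 → ℝ) : Filter ((Fin 3 → ℕ) × ℕ × (Fin 3 → ℝ)) :=
  (atTop ×ˢ ⊤) ⊓ 𝓟 {p | p.2.1 ≤ p.1 0 ∧ p.2.2 ∈ Set.Icc 0 T}

theorem eventually_monitoringFilter {T : Fin 3 → ℝ}
    {Q : (Fin 3 → ℕ) × ℕ × (Fin 3 → ℝ) → Prop} :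
    (∀ᶠ p in monitoringFilter T, Q p) ↔
      ∀ᶠ n in atTop, ∀ k ≤ n 0, ∀ x ∈ Set.Icc 0 T, Q (n, k, x) := by
  rw [monitoringFilter, eventually_inf_principal, eventually_prod_iff]
  constructor
  · rintro ⟨pa, ha, pb, hb, h⟩
    rw [eventually_top] at hb
    filter_upwards [ha] with n hn k hk x hx
    exact h hn (hb (k, x)) ⟨hk, hx⟩
  · intro h
    exact ⟨_, h, fun _ => True, by simp, fun {n} hn {y} _ hy => hn y.1 hy.1 y.2 hy.2⟩

theorem tendsto_fst_monitoringFilter (T : Fin 3 → ℝ) :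
    Tendsto Prod.fst (monitoringFilter T) atTop :=
  tendsto_fst.mono_left inf_le_left

/-- The comparison terms `B₁` and `B₂` vary with `p` and need not converge, so boundedness replaces
the usual limit of a product. -/
theorem tendsto_mul_sub_mul {α : Type*} {l : Filter α} {A₁ A₂ B₁ B₂ : α → ℝ} {C₁ C₂ : ℝ}
    (h₁ : Tendsto (fun p => A₁ p - B₁ p) l (𝓝 0)) (h₂ : Tendsto (fun p => A₂ p - B₂ p) l (𝓝 0))
    (hB₁ : ∀ᶠ p in l, |B₁ p| ≤ C₁) (hB₂ : ∀ᶠ p in l, |B₂ p| ≤ C₂) :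
    Tendsto (fun p => A₁ p * A₂ p - B₁ p * B₂ p) l (𝓝 0) := by
  have e : ∀ p, A₁ p * A₂ p - B₁ p * B₂ p =
      (A₁ p - B₁ p) * (A₂ p - B₂ p) + (A₁ p - B₁ p) * B₂ p + B₁ p * (A₂ p - B₂ p) := fun p => by
    ring
  simp only [e]
  have t1 : Tendsto (fun p => (A₁ p - B₁ p) * B₂ p) l (𝓝 0) :=
    h₁.zero_mul_isBoundedUnder_le ⟨C₂, by simpa [eventually_map] using hB₂⟩
  have t2 : Tendsto (fun p => B₁ p * (A₂ p - B₂ p)) l (𝓝 0) :=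
    isBoundedUnder_le_mul_tendsto_zero ⟨C₁, by simpa [eventually_map] using hB₁⟩ h₂
  simpa using ((h₁.mul h₂).add t1).add t2

theorem tendsto_prod_sub_prod {α ι : Type*} {l : Filter α} (s : Finset ι) {A B : ι → α → ℝ}
    {C : ι → ℝ} (h : ∀ i, Tendsto (fun p => A i p - B i p) l (𝓝 0))
    (hB : ∀ i, ∀ᶠ p in l, |B i p| ≤ C i) :
    Tendsto (fun p => ∏ i ∈ s, A i p - ∏ i ∈ s, B i p) l (𝓝 0) := by
  classical
  induction s using Finset.induction_on with
  | empty => simpa using tendsto_const_nhds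
  | insert i s hi ih =>
    simp only [Finset.prod_insert hi]
    refine tendsto_mul_sub_mul (C₂ := ∏ i ∈ s, C i) (h i) ih (hB i) ?_
    have : ∀ᶠ p in l, ∀ i ∈ s, |B i p| ≤ C i := (Finset.eventually_all s).2 fun i _ => hB i
    filter_upwards [this] with p hp
    rw [Finset.abs_prod]
    exact Finset.prod_le_prod (fun _ _ => abs_nonneg _) hp

section Limit

variable {b : Fin 3 → ℝ} {τ : Fin 3 → ℕ → ℝ} {T : Fin 3 → ℝ}

theorem tendsto_coord_mul (hτT : ∀ j, Tendsto (fun m : ℕ => (m : ℝ) * τ j m) atTop (𝓝 (T j)))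
    (j : Fin 3) : Tendsto (fun n : Fin 3 → ℕ => (n j : ℝ) * τ j (n j)) atTop (𝓝 (T j)) :=
  (hτT j).comp (tendsto_eval_atTop_nat j)

theorem update_le {n : Fin 3 → ℕ} {k : ℕ} (hk : k ≤ n 0) (j : Fin 3) :
    Function.update n 0 k j ≤ n j := by
  rcases eq_or_ne j 0 with rfl | hj
  · simpa using hk
  · simp [hj]

/-- Uniform boundedness of the functionals `gridSum`. -/
theorem exists_abs_gridSum_le (b : Fin 3 → ℝ) (hτ : ∀ j m, 0 < m → 0 < τ j m) (hT : ∀ j, 0 < T j)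
    (hτT : ∀ j, Tendsto (fun m : ℕ => (m : ℝ) * τ j m) atTop (𝓝 (T j))) :
    ∃ C : ℝ, 0 < C ∧ ∀ᶠ n in atTop, ∀ (w : (Fin 3 → I) → ℝ) (δ : ℝ), (∀ v, |w v| ≤ δ) →
      ∀ k ≤ n 0, ∀ x, |gridSum b τ n w k x| ≤ C * δ := by
  -- This is `2 M + (m + 1) κ` from summation by parts, with `M = |b| / π` and `κ = |b|² τ / π`; for
  -- large `n`, `(m + 1) τ ≤ 2 n τ ≤ 2 (T + 1)`.
  set V : Fin 3 → ℝ := fun j => 2 * (|b j| / Real.pi) +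
    2 * (T j + 1) * (|b j| / Real.pi * |b j|) with hV
  have hV0 : ∀ j, 0 ≤ V j := fun j => by
    have := hT j
    have := Real.pi_pos
    positivity
  have hP : 0 ≤ ∏ j, V j := Finset.prod_nonneg fun j _ => hV0 j
  -- Adding 1 only makes the constant strictly positive, since it is divided by later.
  refine ⟨√(∏ j, (T j + 1)) * (∏ j, V j) + 1, by positivity, ?_⟩
  have hle : ∀ᶠ n : Fin 3 → ℕ in atTop, ∀ j, (n j : ℝ) * τ j (n j) < T j + 1 :=
    eventually_all.2 fun j => (tendsto_coord_mul hτT j).eventually_lt_const (by simp)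
  filter_upwards [hle, eventually_forall_pos] with n hn hpos w δ hw k hk x
  have hδ : 0 ≤ δ := (abs_nonneg _).trans (hw 0)
  have hτn : ∀ j, 0 < τ j (n j) := fun j => hτ j _ (hpos j)
  have hcomp : ∀ l : Fin 3 → ℤ, boxIncrement w (gridPoint n (l - 1)) (gridPoint n l) =
      boxIncrement (fun i => w (gridPoint n i)) (l - 1) l := fun l =>
    boxIncrement_comp w (fun j (i : ℤ) => (Set.projIcc 0 1 zero_le_one ((i : ℝ) / n j) : I))
      (l - 1) l
  have key := abs_sum_prod_mul_boxIncrement_le (Function.update n 0 k)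
    (fun j i => sincKernel (b j) (x j - i * τ j (n j))) (fun j => |b j| / Real.pi)
    (fun j => |b j| / Real.pi * |b j| * τ j (n j)) (fun j i => abs_sincKernel_le _ _)
    (fun j i => (abs_sincKernel_sub_le _ _ _).trans_eq (by
      congr 1
      push_cast
      rw [← abs_of_pos (hτn j)]
      congr 1
      rw [abs_of_pos (hτn j)]
      ring))
    (fun i => w (gridPoint n i)) δ (fun i => hw _)
  have hprod : ∏ j, (2 * (|b j| / Real.pi) + ((Function.update n 0 k j : ℕ) + 1) *
      (|b j| / Real.pi * |b j| * τ j (n j))) ≤ ∏ j, V j := by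
    have := Real.pi_pos
    refine Finset.prod_le_prod (fun j _ => ?_) fun j _ => ?_
    · have := hτn j
      positivity
    · have h1 : ((Function.update n 0 k j : ℕ) : ℝ) ≤ n j := by exact_mod_cast update_le hk j
      have h2 : (1 : ℝ) ≤ n j := by exact_mod_cast hpos j
      have h3 : ((Function.update n 0 k j : ℕ) + 1 : ℝ) * τ j (n j) ≤ 2 * (T j + 1) := by
        have : ((Function.update n 0 k j : ℕ) + 1 : ℝ) * τ j (n j) ≤ (2 * n j) * τ j (n j) :=
          mul_le_mul_of_nonneg_right (by linarith) (hτn j).le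
        nlinarith [hn j]
      rw [hV]
      have h4 : 0 ≤ |b j| / Real.pi * |b j| := by positivity
      nlinarith [mul_le_mul_of_nonneg_right h3 h4]
  have hsqrt : √(∏ j, ((n j : ℝ) * τ j (n j))) ≤ √(∏ j, (T j + 1)) :=
    Real.sqrt_le_sqrt (Finset.prod_le_prod
      (fun j _ => mul_nonneg (Nat.cast_nonneg _) (hτn j).le) fun j _ => (hn j).le)
  rw [gridSum, abs_mul, abs_of_nonneg (Real.sqrt_nonneg _)]
  have hsum : |∑ l ∈ indexBox (Function.update n 0 k),
      reconstructionKernel b (x - samplePoint τ n l) *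
      boxIncrement w (gridPoint n (l - 1)) (gridPoint n l)| ≤ δ * ∏ j, V j := by
    refine le_trans (le_of_eq ?_) (key.trans (mul_le_mul_of_nonneg_left hprod hδ))
    congr 1
    refine Finset.sum_congr rfl fun l _ => ?_
    rw [hcomp, reconstructionKernel_eq_prod]
    rfl
  calc √(∏ j, ((n j : ℝ) * τ j (n j))) * |∑ l ∈ indexBox (Function.update n 0 k),
      reconstructionKernel b (x - samplePoint τ n l) *
      boxIncrement w (gridPoint n (l - 1)) (gridPoint n l)|
      ≤ √(∏ j, (T j + 1)) * (δ * ∏ j, V j) :=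
        mul_le_mul hsqrt hsum (abs_nonneg _) (Real.sqrt_nonneg _)
    _ ≤ _ := by nlinarith

theorem gridSum_add (n : Fin 3 → ℕ) (w w' : (Fin 3 → I) → ℝ) (k : ℕ) (x : Fin 3 → ℝ) :
    gridSum b τ n (fun v => w v + w' v) k x = gridSum b τ n w k x + gridSum b τ n w' k x := by
  simp only [gridSum, boxIncrement_add, mul_add, Finset.sum_add_distrib]

theorem gridSum_sub (n : Fin 3 → ℕ) (w w' : (Fin 3 → I) → ℝ) (k : ℕ) (x : Fin 3 → ℝ) :
    gridSum b τ n (fun v => w v - w' v) k x = gridSum b τ n w k x - gridSum b τ n w' k x := by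
  simp only [gridSum, boxIncrement_sub, mul_sub, Finset.sum_sub_distrib]

theorem gridSum_const_mul (n : Fin 3 → ℕ) (c : ℝ) (w : (Fin 3 → I) → ℝ) (k : ℕ) (x : Fin 3 → ℝ) :
    gridSum b τ n (fun v => c * w v) k x = c * gridSum b τ n w k x := by
  simp only [gridSum, boxIncrement_const_mul, mul_left_comm _ c, ← Finset.mul_sum]

/-- `G` is the uniform limit of the functionals `gridSum` at `w`. -/
structure IsGridLimit (b : Fin 3 → ℝ) (τ : Fin 3 → ℕ → ℝ) (T : Fin 3 → ℝ) (w : (Fin 3 → I) → ℝ)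
    (G : ℝ × (Fin 3 → ℝ) → ℝ) : Prop where
  continuousOn : ContinuousOn G (Set.Icc 0 1 ×ˢ Set.Icc 0 T)
  tendsto : Tendsto (fun p : (Fin 3 → ℕ) × ℕ × (Fin 3 → ℝ) =>
    gridSum b τ p.1 w p.2.1 p.2.2 - G ((p.2.1 : ℝ) / p.1 0, p.2.2)) (monitoringFilter T) (𝓝 0)

theorem IsGridLimit.add {w w' : (Fin 3 → I) → ℝ} {G G' : ℝ × (Fin 3 → ℝ) → ℝ}
    (h : IsGridLimit b τ T w G) (h' : IsGridLimit b τ T w' G') :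
    IsGridLimit b τ T (fun v => w v + w' v) (fun y => G y + G' y) where
  continuousOn := h.continuousOn.add h'.continuousOn
  tendsto := by
    have := h.tendsto.add h'.tendsto
    rw [add_zero] at this
    refine this.congr fun p => ?_
    rw [gridSum_add]
    ring

theorem IsGridLimit.const_mul {w : (Fin 3 → I) → ℝ} {G : ℝ × (Fin 3 → ℝ) → ℝ} (c : ℝ)
    (h : IsGridLimit b τ T w G) :
    IsGridLimit b τ T (fun v => c * w v) (fun y => c * G y) where
  continuousOn := continuousOn_const.mul h.continuousOn
  tendsto := by
    have := h.tendsto.const_mul c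
    rw [mul_zero] at this
    refine this.congr fun p => ?_
    rw [gridSum_const_mul]
    ring

theorem floor_mul_le {m : ℕ} {s : ℝ} (hs : s ≤ 1) : ⌊(m : ℝ) * s⌋₊ ≤ m :=
  Nat.floor_le_of_le (mul_le_of_le_one_right (Nat.cast_nonneg _) hs)

theorem tendsto_floor_mul_div {s : ℝ} (hs : 0 ≤ s) :
    Tendsto (fun n : Fin 3 → ℕ => (⌊(n 0 : ℝ) * s⌋₊ : ℝ) / n 0) atTop (𝓝 s) := by
  have h := (tendsto_nat_floor_mul_div_atTop (R := ℝ) hs).comp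
    (tendsto_natCast_atTop_atTop.comp (tendsto_eval_atTop_nat 0))
  refine h.congr fun n => ?_
  simp [mul_comm]

theorem div_mem_Icc {k m : ℕ} (hk : k ≤ m) : (k : ℝ) / m ∈ Set.Icc (0 : ℝ) 1 :=
  ⟨by positivity, div_le_one_of_le₀ (by exact_mod_cast hk) (Nat.cast_nonneg _)⟩

/-- The limit is recovered pointwise from the functionals, hence is determined by `w` on the domain;
bounds on `gridSum` pass to limits through this. -/
theorem IsGridLimit.tendsto_floor {w : (Fin 3 → I) → ℝ} {G : ℝ × (Fin 3 → ℝ) → ℝ}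
    (h : IsGridLimit b τ T w G) {s : ℝ} (hs : s ∈ Set.Icc (0 : ℝ) 1) {x : Fin 3 → ℝ}
    (hx : x ∈ Set.Icc 0 T) :
    Tendsto (fun n => gridSum b τ n w ⌊(n 0 : ℝ) * s⌋₊ x) atTop (𝓝 (G (s, x))) := by
  have h1 : Tendsto (fun n : Fin 3 → ℕ => (n, ⌊(n 0 : ℝ) * s⌋₊, x)) atTop (monitoringFilter T) := by
    rw [monitoringFilter, tendsto_inf, tendsto_principal]
    exact ⟨tendsto_id.prodMk tendsto_top, Eventually.of_forall fun n => ⟨floor_mul_le hs.2, hx⟩⟩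
  have h2 := h.tendsto.comp h1
  have h3 : Tendsto (fun n : Fin 3 → ℕ => ((⌊(n 0 : ℝ) * s⌋₊ : ℝ) / n 0, x)) atTop
      (𝓝[Set.Icc 0 1 ×ˢ Set.Icc 0 T] (s, x)) :=
    tendsto_nhdsWithin_iff.2 ⟨(tendsto_floor_mul_div hs.1).prodMk_nhds tendsto_const_nhds,
      Eventually.of_forall fun n => ⟨div_mem_Icc (floor_mul_le hs.2), hx⟩⟩
  have h4 := (h.continuousOn (s, x) ⟨hs, hx⟩).tendsto.comp h3
  simpa using h2.add h4

/-- By the uniform bound, the limits belonging to approximants of `w` differ by at most a constant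
times the distance of the approximants. They are uniformly Cauchy, and a three-term estimate
identifies their limit. -/
theorem exists_isGridLimit_of_approx (b : Fin 3 → ℝ) (hτ : ∀ j m, 0 < m → 0 < τ j m)
    (hT : ∀ j, 0 < T j) (hτT : ∀ j, Tendsto (fun m : ℕ => (m : ℝ) * τ j m) atTop (𝓝 (T j)))
    (w : (Fin 3 → I) → ℝ)
    (h : ∀ δ > 0, ∃ w' G', IsGridLimit b τ T w' G' ∧ ∀ v, |w' v - w v| ≤ δ) :
    ∃ G, IsGridLimit b τ T w G := by
  obtain ⟨C, hC, hbound⟩ := exists_abs_gridSum_le b hτ hT hτT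
  choose w' G' hG' hw' using fun i : ℕ => h (1 / ((i : ℝ) + 1)) (by positivity)
  have hdiff : ∀ i j, ∀ y ∈ Set.Icc (0 : ℝ) 1 ×ˢ Set.Icc 0 T, |G' i y - G' j y| ≤
      C * (1 / ((i : ℝ) + 1) + 1 / ((j : ℝ) + 1)) := by
    rintro i j ⟨s, x⟩ ⟨hs, hx⟩
    have ht := (((hG' i).tendsto_floor hs hx).sub ((hG' j).tendsto_floor hs hx)).abs
    refine le_of_tendsto ht ?_
    filter_upwards [hbound] with n hn
    rw [← gridSum_sub]
    refine hn _ _ (fun v => ?_) _ (floor_mul_le hs.2) _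
    have := hw' j v
    rw [abs_sub_comm] at this
    calc |w' i v - w' j v| = |(w' i v - w v) + (w v - w' j v)| := by ring_nf
      _ ≤ _ := (abs_add_le _ _).trans (add_le_add (hw' i v) this)
  have hlim0 : Tendsto (fun i : ℕ => C * (1 / ((i : ℝ) + 1))) atTop (𝓝 0) := by
    simpa using tendsto_one_div_add_atTop_nhds_zero_nat.const_mul C
  have hcauchy : UniformCauchySeqOn G' atTop (Set.Icc 0 1 ×ˢ Set.Icc 0 T) := by
    rw [Metric.uniformCauchySeqOn_iff]
    intro ε hε
    obtain ⟨N, hN⟩ := eventually_atTop.1 (hlim0.eventually_lt_const (half_pos hε))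
    refine ⟨N, fun i hi j hj y hy => (hdiff i j y hy).trans_lt ?_⟩
    have := hN i hi
    have := hN j hj
    linarith
  have hpt : ∀ y, ∃ g, y ∈ Set.Icc (0 : ℝ) 1 ×ˢ Set.Icc 0 T →
      Tendsto (fun i => G' i y) atTop (𝓝 g) := by
    intro y
    by_cases hy : y ∈ Set.Icc (0 : ℝ) 1 ×ˢ Set.Icc 0 T
    · obtain ⟨g, hg⟩ := cauchySeq_tendsto_of_complete (hcauchy.cauchySeq hy)
      exact ⟨g, fun _ => hg⟩
    · exact ⟨0, fun h => absurd h hy⟩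
  choose G hG using hpt
  have hunif : TendstoUniformlyOn G' G atTop (Set.Icc 0 1 ×ˢ Set.Icc 0 T) :=
    hcauchy.tendstoUniformlyOn_of_tendsto fun y hy => hG y hy
  refine ⟨G, hunif.continuousOn (Eventually.of_forall fun i => (hG' i).continuousOn).frequently, ?_⟩
  rw [Metric.tendsto_nhds]
  intro ε hε
  have hε3 : 0 < ε / 3 := by positivity
  obtain ⟨i, hi1, hi2⟩ := ((hlim0.eventually_lt_const hε3).and
    (Metric.tendstoUniformlyOn_iff.1 hunif _ hε3)).exists
  have h1 := Metric.tendsto_nhds.1 (hG' i).tendsto _ hε3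
  rw [eventually_monitoringFilter] at h1 ⊢
  filter_upwards [h1, hbound] with n hn1 hn2 k hk x hx
  have e1 := hn1 k hk x hx
  have e2 := hi2 ((k : ℝ) / n 0, x) ⟨div_mem_Icc hk, hx⟩
  have e3 := hn2 (fun v => w' i v - w v) _ (hw' i) k hk x
  rw [gridSum_sub] at e3
  rw [Real.dist_eq] at *
  simp only [sub_zero] at *
  rw [abs_lt] at *
  rw [abs_le] at e3
  constructor <;> linarith [e1.1, e1.2, e2.1, e2.2, e3.1, e3.2]

theorem tendsto_riemannStieltjes_sub_integral {α : Type*} {l : Filter α} {n k : α → ℕ}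
    (hn : Tendsto n l atTop) (hk : ∀ᶠ p in l, k p ≤ n p) {g : α → ℝ → ℝ} {κ : ℝ}
    (hg : ∀ p y y', |g p y - g p y'| ≤ κ * |y - y'|) {t : ℕ → ℝ} {T : ℝ} (hT : 0 ≤ T)
    (ht : Tendsto (fun m : ℕ => (m : ℝ) * t m) atTop (𝓝 T))
    {P P' : ℝ → ℝ} (hP : ∀ v, HasDerivAt P (P' v) v) (hP' : Continuous P') :
    Tendsto (fun p => ∑ i ∈ Finset.Icc (1 : ℤ) (k p), g p (i * t (n p)) *
      (P (i / n p) - P ((i - 1) / n p)) - ∫ v in (0 : ℝ)..(k p / n p), g p (T * v) * P' v)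
      l (𝓝 0) := by
  obtain ⟨D, hD⟩ := isCompact_Icc.exists_bound_of_continuousOn (s := Set.Icc (0 : ℝ) 1)
    hP'.continuousOn
  have h1 : Tendsto (fun m : ℕ => κ * (|(m : ℝ) * t m - T| + T / m) * D) atTop (𝓝 0) := by
    have h2 : Tendsto (fun m : ℕ => |(m : ℝ) * t m - T|) atTop (𝓝 0) := by
      simpa using (ht.sub_const T).abs
    simpa using ((h2.add (tendsto_const_div_atTop_nhds_zero_nat T)).const_mul κ).mul_const D
  refine squeeze_zero_norm' ?_ (h1.comp hn)
  filter_upwards [hk, hn.eventually (eventually_gt_atTop 0)] with p hp hp0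
  exact abs_riemannStieltjes_sub_integral_le (hg p) hP hP' hD hp0 hp _ hT

theorem abs_integral_le_of_le_one {f : ℝ → ℝ} {D s : ℝ} (hD : ∀ v ∈ Set.Icc (0 : ℝ) 1, |f v| ≤ D)
    (hs : s ∈ Set.Icc (0 : ℝ) 1) : |∫ v in (0 : ℝ)..s, f v| ≤ D := by
  have hD0 : 0 ≤ D := (abs_nonneg _).trans (hD 0 (by simp))
  have := intervalIntegral.norm_integral_le_of_norm_le_const (a := 0) (b := s) (f := f) (C := D)
    fun v hv => by
      rw [Set.uIoc_of_le hs.1] at hv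
      exact hD v ⟨hv.1.le, hv.2.trans hs.2⟩
  rw [sub_zero, abs_of_nonneg hs.1] at this
  exact this.trans (mul_le_of_le_one_right hD0 hs.2)

theorem update_div_mem_Icc {n : Fin 3 → ℕ} {k : ℕ} (hk : k ≤ n 0) (j : Fin 3) :
    ((Function.update n 0 k j : ℕ) : ℝ) / n j ∈ Set.Icc (0 : ℝ) 1 := div_mem_Icc (update_le hk j)

theorem update_div_eq {n : Fin 3 → ℕ} (hn : ∀ j, 0 < n j) (k : ℕ) (j : Fin 3) :
    ((Function.update n 0 k j : ℕ) : ℝ) / n j =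
      Function.update (1 : Fin 3 → ℝ) 0 ((k : ℝ) / n 0) j := by
  rcases eq_or_ne j 0 with rfl | hj
  · simp
  · simp [hj, (hn j).ne']

theorem sum_indexBox_prod (m : Fin 3 → ℕ) (f : Fin 3 → ℤ → ℝ) :
    ∑ l ∈ indexBox m, ∏ j, f j (l j) = ∏ j, ∑ i ∈ Finset.Icc (1 : ℤ) (m j), f j i := by
  rw [indexBox, Finset.prod_univ_sum]

/-- Uniformity in `x` holds because the Lipschitz constant of the kernel is unaffected by shifts. -/
theorem tendsto_stieltjes_factor (hT : ∀ j, 0 < T j)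
    (hτT : ∀ j, Tendsto (fun m : ℕ => (m : ℝ) * τ j m) atTop (𝓝 (T j))) (j : Fin 3) (a : ℕ) :
    Tendsto (fun p : (Fin 3 → ℕ) × ℕ × (Fin 3 → ℝ) =>
      ∑ i ∈ Finset.Icc (1 : ℤ) (Function.update p.1 0 p.2.1 j : ℕ),
        sincKernel (b j) (p.2.2 j - i * τ j (p.1 j)) *
          (((i : ℝ) / p.1 j) ^ a - (((i : ℝ) - 1) / p.1 j) ^ a) -
      ∫ v in (0 : ℝ)..((Function.update p.1 0 p.2.1 j : ℕ) : ℝ) / p.1 j,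
          sincKernel (b j) (p.2.2 j - T j * v) * (a * v ^ (a - 1)))
      (monitoringFilter T) (𝓝 0) := by
  have hk : ∀ᶠ p in monitoringFilter T, Function.update p.1 0 p.2.1 j ≤ p.1 j := by
    rw [eventually_monitoringFilter]
    exact Eventually.of_forall fun n k hk x _ => update_le hk j
  have hg : ∀ (p : (Fin 3 → ℕ) × ℕ × (Fin 3 → ℝ)) (y y' : ℝ),
      |sincKernel (b j) (p.2.2 j - y) - sincKernel (b j) (p.2.2 j - y')| ≤
        |b j| / Real.pi * |b j| * |y - y'| := by
    intro p y y'
    refine (abs_sincKernel_sub_le _ _ _).trans_eq ?_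
    rw [sub_sub_sub_cancel_left, abs_sub_comm]
  exact tendsto_riemannStieltjes_sub_integral
    ((tendsto_eval_atTop_nat j).comp (tendsto_fst_monitoringFilter T)) hk hg (hT j).le (hτT j)
    (fun v => hasDerivAt_pow a v) (by fun_prop)

/-- Kernel and increment both factor over coordinates, leaving a product of Riemann-Stieltjes sums
against powers. Only the time coordinate is cut off, whence the upper limit given by
`Function.update`. -/
theorem isGridLimit_monomial (b : Fin 3 → ℝ) (hτ : ∀ j m, 0 < m → 0 < τ j m)
    (hT : ∀ j, 0 < T j) (hτT : ∀ j, Tendsto (fun m : ℕ => (m : ℝ) * τ j m) atTop (𝓝 (T j)))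
    (a : Fin 3 → ℕ) :
    IsGridLimit b τ T (fun v => ∏ j, (v j : ℝ) ^ a j) (fun y => ∏ j, (√(T j) *
      ∫ v in (0 : ℝ)..Function.update (1 : Fin 3 → ℝ) 0 y.1 j,
        sincKernel (b j) (y.2 j - T j * v) * (a j * v ^ (a j - 1)))) where
  continuousOn := by
    refine Continuous.continuousOn (continuous_finsetProd _ fun j _ => continuous_const.mul ?_)
    refine intervalIntegral.continuous_parametric_intervalIntegral_of_continuous
      (f := fun (y : ℝ × (Fin 3 → ℝ)) (v : ℝ) =>
        sincKernel (b j) (y.2 j - T j * v) * (a j * v ^ (a j - 1))) ?_ ?_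
    · fun_prop
    · exact (continuous_apply j).comp
        ((continuous_const (y := (1 : Fin 3 → ℝ))).update 0 continuous_fst)
  tendsto := by
    have hfac : ∀ᶠ p in monitoringFilter T, gridSum b τ p.1 (fun v => ∏ j, (v j : ℝ) ^ a j) p.2.1
        p.2.2 = ∏ j, (√((p.1 j : ℝ) * τ j (p.1 j)) *
          ∑ i ∈ Finset.Icc (1 : ℤ) (Function.update p.1 0 p.2.1 j : ℕ),
            sincKernel (b j) (p.2.2 j - i * τ j (p.1 j)) *
              (((i : ℝ) / p.1 j) ^ a j - (((i : ℝ) - 1) / p.1 j) ^ a j)) := by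
      rw [eventually_monitoringFilter]
      filter_upwards [eventually_forall_pos] with n hn k hk x _
      rw [gridSum, Real.sqrt_prod _ fun j _ => mul_nonneg (Nat.cast_nonneg _) (hτ j _ (hn j)).le,
        Finset.prod_mul_distrib, ← sum_indexBox_prod]
      congr 1
      refine Finset.sum_congr rfl fun l hl => ?_
      have hl' : ∀ j, 1 ≤ l j ∧ l j ≤ n j := by
        simpa [indexBox, Fintype.mem_piFinset] using indexBox_update_subset hk hl
      rw [boxIncrement_prod (fun j (y : I) => (y : ℝ) ^ a j), reconstructionKernel_eq_prod,
        ← Finset.prod_mul_distrib]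
      refine Finset.prod_congr rfl fun j _ => ?_
      have := hl' j
      rw [gridPoint, gridPoint, coe_projIcc_div (by omega) (by omega),
        coe_projIcc_div (by simp; omega) (by simp; omega)]
      simp [samplePoint]
    have hlim : ∀ᶠ p in monitoringFilter T, (∏ j, (√(T j) *
        ∫ v in (0 : ℝ)..Function.update (1 : Fin 3 → ℝ) 0 ((p.2.1 : ℝ) / p.1 0) j,
          sincKernel (b j) (p.2.2 j - T j * v) * (a j * v ^ (a j - 1)))) =
        ∏ j, (√(T j) * ∫ v in (0 : ℝ)..((Function.update p.1 0 p.2.1 j : ℕ) : ℝ) / p.1 j,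
          sincKernel (b j) (p.2.2 j - T j * v) * (a j * v ^ (a j - 1))) := by
      rw [eventually_monitoringFilter]
      filter_upwards [eventually_forall_pos] with n hn k hk x _
      simp only [update_div_eq hn]
    have hbd : ∀ j, ∀ᶠ p in monitoringFilter T,
        |∫ v in (0 : ℝ)..((Function.update p.1 0 p.2.1 j : ℕ) : ℝ) / p.1 j,
          sincKernel (b j) (p.2.2 j - T j * v) * (a j * v ^ (a j - 1))| ≤
        |b j| / Real.pi * a j := by
      intro j
      rw [eventually_monitoringFilter]
      refine Eventually.of_forall fun n k hk x _ => ?_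
      refine abs_integral_le_of_le_one (fun v hv => ?_) (update_div_mem_Icc hk j)
      rw [abs_mul, abs_of_nonneg (a := (a j : ℝ) * v ^ (a j - 1))
        (mul_nonneg (Nat.cast_nonneg _) (pow_nonneg hv.1 _))]
      have := Real.pi_pos
      exact mul_le_mul (abs_sincKernel_le _ _) (mul_le_of_le_one_right (Nat.cast_nonneg _)
        (pow_le_one₀ hv.1 hv.2)) (mul_nonneg (Nat.cast_nonneg _) (pow_nonneg hv.1 _))
        (by positivity)
    have hmain := tendsto_prod_sub_prod (l := monitoringFilter T) Finset.univ
      (A := fun j p => √((p.1 j : ℝ) * τ j (p.1 j)) *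
          ∑ i ∈ Finset.Icc (1 : ℤ) (Function.update p.1 0 p.2.1 j : ℕ),
            sincKernel (b j) (p.2.2 j - i * τ j (p.1 j)) *
              (((i : ℝ) / p.1 j) ^ a j - (((i : ℝ) - 1) / p.1 j) ^ a j))
      (B := fun j p => √(T j) *
        ∫ v in (0 : ℝ)..((Function.update p.1 0 p.2.1 j : ℕ) : ℝ) / p.1 j,
          sincKernel (b j) (p.2.2 j - T j * v) * (a j * v ^ (a j - 1)))
      (C := fun j => √(T j) * (|b j| / Real.pi * a j)) ?_ ?_
    · refine hmain.congr' ?_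
      filter_upwards [hfac, hlim] with p h1 h2
      rw [h1, h2]
    · intro j
      refine tendsto_mul_sub_mul (C₁ := √(T j)) (C₂ := |b j| / Real.pi * a j) ?_ ?_ ?_ (hbd j)
      · have := ((Real.continuous_sqrt.tendsto _).comp
          ((tendsto_coord_mul hτT j).comp (tendsto_fst_monitoringFilter T))).sub_const (√(T j))
        simpa using this
      · exact tendsto_stieltjes_factor hT hτT j (a j)
      · exact Eventually.of_forall fun p => by rw [abs_of_nonneg (Real.sqrt_nonneg _)]
    · intro j
      filter_upwards [hbd j] with p hp
      rw [abs_mul, abs_of_nonneg (Real.sqrt_nonneg _)]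
      exact mul_le_mul_of_nonneg_left hp (Real.sqrt_nonneg _)

/-! ### From monomials to all continuous functions. -/

/-- The coordinate functions on the cube. -/
def cubeCoord (j : Fin 3) : C(Fin 3 → I, ℝ) := ⟨fun v => v j, by fun_prop⟩

theorem exists_isGridLimit_mvPolynomial (b : Fin 3 → ℝ) (hτ : ∀ j m, 0 < m → 0 < τ j m)
    (hT : ∀ j, 0 < T j) (hτT : ∀ j, Tendsto (fun m : ℕ => (m : ℝ) * τ j m) atTop (𝓝 (T j)))
    (p : MvPolynomial (Fin 3) ℝ) :
    ∃ G, IsGridLimit b τ T (MvPolynomial.aeval cubeCoord p : C(Fin 3 → I, ℝ)) G := by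
  induction p using MvPolynomial.induction_on' with
  | monomial u a =>
    have heq : ((MvPolynomial.aeval cubeCoord (MvPolynomial.monomial u a) : C(Fin 3 → I, ℝ)) :
        (Fin 3 → I) → ℝ) = fun v => a * ∏ j, (v j : ℝ) ^ u j := by
      funext v
      rw [MvPolynomial.aeval_monomial, Finsupp.prod_fintype _ _ (by simp)]
      simp [cubeCoord]
    rw [heq]
    exact ⟨_, (isGridLimit_monomial b hτ hT hτT u).const_mul a⟩
  | add p q hp hq =>
    obtain ⟨G, hG⟩ := hp
    obtain ⟨G', hG'⟩ := hq
    rw [map_add]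
    exact ⟨_, hG.add hG'⟩

/-- At continuous functions the functionals `gridSum` converge uniformly. -/
theorem exists_isGridLimit (b : Fin 3 → ℝ) (hτ : ∀ j m, 0 < m → 0 < τ j m)
    (hT : ∀ j, 0 < T j) (hτT : ∀ j, Tendsto (fun m : ℕ => (m : ℝ) * τ j m) atTop (𝓝 (T j)))
    {w : (Fin 3 → I) → ℝ} (hw : Continuous w) : ∃ G, IsGridLimit b τ T w G := by
  refine exists_isGridLimit_of_approx b hτ hT hτT w fun δ hδ => ?_
  -- Hypothesis of Stone-Weierstrass: the coordinate functions already separate points.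
  have hsep : (MvPolynomial.aeval (R := ℝ) cubeCoord).range.SeparatesPoints := by
    intro v v' hne
    obtain ⟨j, hj⟩ := Function.ne_iff.1 hne
    refine ⟨_, ⟨cubeCoord j, ⟨MvPolynomial.X j, by simp⟩, rfl⟩, ?_⟩
    simpa [cubeCoord, Subtype.ext_iff] using hj
  obtain ⟨⟨g, p, rfl⟩, hg⟩ :=
    ContinuousMap.exists_mem_subalgebra_near_continuous_of_separatesPoints _ hsep w hw δ hδ
  obtain ⟨G, hG⟩ := exists_isGridLimit_mvPolynomial b hτ hT hτT p
  exact ⟨_, G, hG, fun v => (hg v).le⟩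

/-- The limit of the functionals `gridSum`. -/
def limitFunctional (b : Fin 3 → ℝ) (τ : Fin 3 → ℕ → ℝ) (w : (Fin 3 → I) → ℝ) (s : ℝ)
    (x : Fin 3 → ℝ) : ℝ :=
  limUnder atTop fun n => gridSum b τ n w ⌊(n 0 : ℝ) * s⌋₊ x

theorem isGridLimit_limitFunctional (b : Fin 3 → ℝ) (hτ : ∀ j m, 0 < m → 0 < τ j m)
    (hT : ∀ j, 0 < T j) (hτT : ∀ j, Tendsto (fun m : ℕ => (m : ℝ) * τ j m) atTop (𝓝 (T j)))
    {w : (Fin 3 → I) → ℝ} (hw : Continuous w) :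
    IsGridLimit b τ T w (fun y => limitFunctional b τ w y.1 y.2) := by
  obtain ⟨G, hG⟩ := exists_isGridLimit b hτ hT hτT hw
  have heq : ∀ y ∈ Set.Icc (0 : ℝ) 1 ×ˢ Set.Icc 0 T, limitFunctional b τ w y.1 y.2 = G y :=
    fun y hy => (hG.tendsto_floor hy.1 hy.2).limUnder_eq
  refine ⟨hG.continuousOn.congr heq, hG.tendsto.congr' ?_⟩
  have : ∀ᶠ p in monitoringFilter T, ((p.2.1 : ℝ) / p.1 0, p.2.2) ∈
      Set.Icc (0 : ℝ) 1 ×ˢ Set.Icc 0 T := by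
    rw [eventually_monitoringFilter]
    exact Eventually.of_forall fun n k hk x hx => ⟨div_mem_Icc hk, hx⟩
  filter_upwards [this] with p hp
  rw [heq _ hp]

end Limit

/-! ## Gaussian laws -/

theorem hasLaw_gaussianReal_linearCombination {Ω ι : Type*} [MeasurableSpace Ω] {P : Measure Ω}
    [IsProbabilityMeasure P] [Fintype ι] {X : ι → Ω → ℝ} {v : ι → ℝ≥0}
    (hX : ∀ i, HasLaw (X i) (gaussianReal 0 (v i)) P) (hind : iIndepFun X P) (G : ι → ℝ) :
    HasLaw (fun ω => ∑ i, G i * X i ω) (gaussianReal 0 (∑ i, G i ^ 2 * (v i : ℝ)).toNNReal) P := by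
  have hg : ∀ i, HasGaussianLaw (fun ω => G i * X i ω) P := fun i =>
    (hX i).hasGaussianLaw.fun_smul (G i)
  have hind' : iIndepFun (fun i ω => G i * X i ω) P :=
    hind.comp (fun i y => G i * y) fun i => measurable_const_mul (G i)
  have hsum := (hind'.hasGaussianLaw hg).fun_sum
  have hmean : ∫ ω, ∑ i, G i * X i ω ∂P = 0 := by
    rw [integral_finsetSum _ fun i _ => (hg i).integrable]
    refine Finset.sum_eq_zero fun i _ => ?_
    rw [integral_const_mul, (hX i).integral_eq, integral_id_gaussianReal, mul_zero]
  have hvar : Var[fun ω => ∑ i, G i * X i ω; P] = ∑ i, G i ^ 2 * (v i : ℝ) := by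
    have h := IndepFun.variance_sum (s := Finset.univ) (X := fun i ω => G i * X i ω)
      (fun i _ => (hg i).memLp_two) (fun i _ j _ hij => hind'.indepFun hij)
    have e : (∑ i, fun ω => G i * X i ω) = fun ω => ∑ i, G i * X i ω := by
      ext ω
      simp
    rw [e] at h
    rw [h]
    refine Finset.sum_congr rfl fun i _ => ?_
    rw [variance_const_mul, (hX i).variance_eq, variance_id_gaussianReal]
  refine ⟨hsum.aemeasurable, ?_⟩
  rw [hsum.map_eq_gaussianReal, hmean, hvar]

/-- An almost sure limit of centred Gaussian variables with converging variances is Gaussian. -/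
theorem hasLaw_gaussianReal_of_tendsto {Ω α : Type*} [MeasurableSpace Ω] {P : Measure Ω}
    [IsProbabilityMeasure P] {l : Filter α} [l.IsCountablyGenerated] [l.NeBot]
    {Y : α → Ω → ℝ} {Z : Ω → ℝ} {v : α → ℝ} {v₀ : ℝ}
    (hY : ∀ᶠ n in l, HasLaw (Y n) (gaussianReal 0 (v n).toNNReal) P)
    (hlim : ∀ᵐ ω ∂P, Tendsto (fun n => Y n ω) l (𝓝 (Z ω))) (hv : Tendsto v l (𝓝 v₀)) :
    HasLaw Z (gaussianReal 0 v₀.toNNReal) P := by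
  -- Measurability of the limit is obtained along a sequence; the law is then identified through
  -- characteristic functions along the whole filter.
  obtain ⟨u, hu⟩ := l.exists_seq_tendsto
  have hZm : AEMeasurable Z P := by
    obtain ⟨N, hN⟩ := eventually_atTop.1 (hu.eventually hY)
    refine aemeasurable_of_tendsto_metrizable_ae atTop (f := fun i ω => Y (u (i + N)) ω)
      (fun i => (hN _ (by omega)).aemeasurable) ?_
    filter_upwards [hlim] with ω hω
    exact hω.comp (hu.comp (tendsto_add_atTop_nat N))
  refine ⟨hZm, ?_⟩
  have : IsProbabilityMeasure (P.map Z) := Measure.isProbabilityMeasure_map hZm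
  refine Measure.ext_of_charFun (funext fun t => ?_)
  rw [charFun_apply_real, charFun_gaussianReal, integral_map hZm (by fun_prop)]
  have h1 : Tendsto (fun n => ∫ ω, Complex.exp (t * (Y n ω : ℂ) * Complex.I) ∂P) l
      (𝓝 (∫ ω, Complex.exp (t * (Z ω : ℂ) * Complex.I) ∂P)) := by
    refine tendsto_integral_filter_of_dominated_convergence (fun _ => 1) ?_ ?_
      (integrable_const _) ?_
    · filter_upwards [hY] with n hn
      have hc : Continuous fun y : ℝ => Complex.exp (t * (y : ℂ) * Complex.I) := by fun_prop
      exact hc.comp_aestronglyMeasurable hn.aemeasurable.aestronglyMeasurable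
    · refine Eventually.of_forall fun n => Eventually.of_forall fun ω => ?_
      rw [← Complex.ofReal_mul, Complex.norm_exp_ofReal_mul_I]
    · filter_upwards [hlim] with ω hω
      have hc : Continuous fun y : ℝ => Complex.exp (t * (y : ℂ) * Complex.I) := by fun_prop
      exact (hc.tendsto _).comp hω
  have h2 : Tendsto (fun n => ∫ ω, Complex.exp (t * (Y n ω : ℂ) * Complex.I) ∂P) l
      (𝓝 (Complex.exp (t * (0 : ℝ) * Complex.I - (v₀.toNNReal : ℝ) * t ^ 2 / 2))) := by
    have h3 : Tendsto (fun n => Complex.exp (t * (0 : ℝ) * Complex.I -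
        ((v n).toNNReal : ℝ) * t ^ 2 / 2)) l
        (𝓝 (Complex.exp (t * (0 : ℝ) * Complex.I - (v₀.toNNReal : ℝ) * t ^ 2 / 2))) := by
      have hc : Continuous fun y : ℝ => Complex.exp (t * (0 : ℝ) * Complex.I -
          (y.toNNReal : ℝ) * t ^ 2 / 2) := by fun_prop
      exact (hc.tendsto v₀).comp hv
    refine h3.congr' ?_
    filter_upwards [hY] with n hn
    rw [← integral_map (φ := Y n) (f := fun y : ℝ => Complex.exp (t * (y : ℂ) * Complex.I))
      hn.aemeasurable (by fun_prop), ← charFun_apply_real, hn.map_eq, charFun_gaussianReal]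
  exact tendsto_nhds_unique h1 h2

/-! ## The covariance function -/

/-- The one-dimensional factors of the covariance function. -/
def covFactor (b T s x x' : ℝ) : ℝ :=
  ∫ v in (0 : ℝ)..s, sincKernel b (x - T * v) * sincKernel b (x' - T * v)

/-- The product kernel splits the triple integral; the cut-off `min s s'` concerns the time factor
alone. -/
theorem limitCov_eq_prod (b T : Fin 3 → ℝ) (sig s s' : ℝ) (x x' : Fin 3 → ℝ) :
    limitCov b T sig s x s' x' = sig ^ 2 * ∏ j, (T j *
      covFactor (b j) (T j) (Function.update (1 : Fin 3 → ℝ) 0 (min s s') j) (x j) (x' j)) := by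
  have h : ∀ z₁ z₂ z₃ : ℝ, reconstructionKernel b (x - T * ![z₁, z₂, z₃]) *
      reconstructionKernel b (x' - T * ![z₁, z₂, z₃]) =
      (sincKernel (b 0) (x 0 - T 0 * z₁) * sincKernel (b 0) (x' 0 - T 0 * z₁)) *
      ((sincKernel (b 1) (x 1 - T 1 * z₂) * sincKernel (b 1) (x' 1 - T 1 * z₂)) *
      (sincKernel (b 2) (x 2 - T 2 * z₃) * sincKernel (b 2) (x' 2 - T 2 * z₃))) := by
    intro z₁ z₂ z₃
    simp only [reconstructionKernel_eq_prod, Fin.prod_univ_three, Pi.sub_apply, Pi.mul_apply,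
      Matrix.cons_val_zero, Matrix.cons_val_one, Matrix.cons_val]
    ring
  simp only [limitCov, h, intervalIntegral.integral_const_mul, intervalIntegral.integral_mul_const]
  simp only [Fin.prod_univ_three, covFactor, Function.update_self, ne_eq, Fin.isValue,
    one_ne_zero, not_false_eq_true, Function.update_of_ne, Pi.one_apply,
    (by decide : (2 : Fin 3) ≠ 0)]
  ring

theorem limitCov_comm (b T : Fin 3 → ℝ) (sig s s' : ℝ) (x x' : Fin 3 → ℝ) :
    limitCov b T sig s x s' x' = limitCov b T sig s' x' s x := by
  simp only [limitCov_eq_prod, covFactor, min_comm s s', mul_comm]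

theorem continuous_covFactor (b T : ℝ) :
    Continuous fun y : ℝ × ℝ × ℝ => covFactor b T y.1 y.2.1 y.2.2 := by
  refine intervalIntegral.continuous_parametric_intervalIntegral_of_continuous
    (f := fun (y : ℝ × ℝ × ℝ) (v : ℝ) => sincKernel b (y.2.1 - T * v) *
      sincKernel b (y.2.2 - T * v)) ?_ continuous_fst
  fun_prop

theorem continuous_limitCov (b T : Fin 3 → ℝ) (sig : ℝ) :
    Continuous fun y : (ℝ × (Fin 3 → ℝ)) × (ℝ × (Fin 3 → ℝ)) =>
      limitCov b T sig y.1.1 y.1.2 y.2.1 y.2.2 := by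
  simp only [limitCov_eq_prod]
  refine continuous_const.mul (continuous_finsetProd _ fun j _ => continuous_const.mul ?_)
  have hu : Continuous fun y : (ℝ × (Fin 3 → ℝ)) × (ℝ × (Fin 3 → ℝ)) =>
      Function.update (1 : Fin 3 → ℝ) 0 (min y.1.1 y.2.1) j :=
    (continuous_apply j).comp ((continuous_const (y := (1 : Fin 3 → ℝ))).update 0
      ((continuous_fst.comp continuous_fst).min (continuous_fst.comp continuous_snd)))
  have hx : Continuous fun y : (ℝ × (Fin 3 → ℝ)) × (ℝ × (Fin 3 → ℝ)) => (y.1.2 j, y.2.2 j) := by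
    fun_prop
  exact (continuous_covFactor (b j) (T j)).comp (hu.prodMk hx)

/-- Each factor integrates a square that is nonzero at `v = x j / T j`, where the kernel equals `b j
/ π`. In the time coordinate this point lies in the range of integration because monitored points
satisfy `x 0 ≤ s * T 0`. -/
theorem limitCov_self_pos {b T : Fin 3 → ℝ} (hb : ∀ j, 0 < b j) (hT : ∀ j, 0 < T j) {sig : ℝ}
    (hsig : 0 < sig) {s : ℝ} (hs : 0 < s) {x : Fin 3 → ℝ} (hx : x ∈ monitoringRegion T s) :
    0 < limitCov b T sig s x s x := by
  rw [limitCov_eq_prod, min_self]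
  refine mul_pos (by positivity) (Finset.prod_pos fun j _ => mul_pos (hT j) ?_)
  have hr : 0 < Function.update (1 : Fin 3 → ℝ) 0 s j := by
    rcases eq_or_ne j 0 with rfl | hj
    · simpa using hs
    · simp [hj]
  have hxj : 0 ≤ x j ∧ x j ≤ Function.update (1 : Fin 3 → ℝ) 0 s j * T j := by
    obtain ⟨h0, h1, h2⟩ := hx
    fin_cases j
    · simpa using h0
    · simpa using h1
    · simpa using h2
  refine intervalIntegral.integral_pos hr (Continuous.continuousOn (by fun_prop))
    (fun v _ => mul_self_nonneg _) ⟨x j / T j, ⟨div_nonneg hxj.1 (hT j).le,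
      (div_le_iff₀ (hT j)).2 hxj.2⟩, ?_⟩
  rw [mul_div_cancel₀ _ (hT j).ne', sub_self, sincKernel_zero]
  have := hb j
  have := Real.pi_pos
  positivity

/-- Covariance of two values of the functional `gridSum` of Brownian motion. -/
def gridCov (b : Fin 3 → ℝ) (τ : Fin 3 → ℕ → ℝ) (sig : ℝ) (n : Fin 3 → ℕ) (k : ℕ)
    (x x' : Fin 3 → ℝ) : ℝ :=
  sig ^ 2 * ∏ j, (n j * τ j (n j) * ∑ i ∈ Finset.Icc (1 : ℤ) (Function.update n 0 k j : ℕ),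
    sincKernel (b j) (x j - i * τ j (n j)) * sincKernel (b j) (x' j - i * τ j (n j)) *
      ((i : ℝ) / n j - ((i : ℝ) - 1) / n j))

theorem abs_mul_sub_mul_le {g h : ℝ → ℝ} {M κ : ℝ} (hg : ∀ y, |g y| ≤ M) (hh : ∀ y, |h y| ≤ M)
    (hg' : ∀ y y', |g y - g y'| ≤ κ * |y - y'|) (hh' : ∀ y y', |h y - h y'| ≤ κ * |y - y'|)
    (y y' : ℝ) : |g y * h y - g y' * h y'| ≤ (2 * M * κ) * |y - y'| := by
  have e : g y * h y - g y' * h y' = (g y - g y') * h y + g y' * (h y - h y') := by ring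
  have hM : 0 ≤ M := (abs_nonneg _).trans (hg 0)
  rw [e]
  refine (abs_add_le _ _).trans ?_
  rw [abs_mul, abs_mul]
  have h1 := mul_le_mul (hg' y y') (hh y) (abs_nonneg _) ((abs_nonneg _).trans (hg' y y'))
  have h2 := mul_le_mul (hg y') (hh' y y') (abs_nonneg _) hM
  linarith

/-- This is the Riemann-Stieltjes estimate with the identity as integrator; the integrand is a
product of two bounded Lipschitz kernels. -/
theorem tendsto_gridCov (b : Fin 3 → ℝ) {τ : Fin 3 → ℕ → ℝ} {T : Fin 3 → ℝ} (hT : ∀ j, 0 < T j)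
    (hτT : ∀ j, Tendsto (fun m : ℕ => (m : ℝ) * τ j m) atTop (𝓝 (T j))) (sig : ℝ) {s s' : ℝ}
    (hs : s ∈ Set.Icc (0 : ℝ) 1) (hs' : s' ∈ Set.Icc (0 : ℝ) 1) (x x' : Fin 3 → ℝ) :
    Tendsto (fun n => gridCov b τ sig n (min ⌊(n 0 : ℝ) * s⌋₊ ⌊(n 0 : ℝ) * s'⌋₊) x x') atTop
      (𝓝 (limitCov b T sig s x s' x')) := by
  rw [limitCov_eq_prod]
  have hmin : ∀ n : Fin 3 → ℕ, min ⌊(n 0 : ℝ) * s⌋₊ ⌊(n 0 : ℝ) * s'⌋₊ =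
      ⌊(n 0 : ℝ) * min s s'⌋₊ := fun n => by
    rw [mul_min_of_nonneg _ _ (Nat.cast_nonneg _), Nat.floor_mono.map_min]
  simp only [hmin]
  have hr : min s s' ∈ Set.Icc (0 : ℝ) 1 := ⟨le_min hs.1 hs'.1, (min_le_left _ _).trans hs.2⟩
  refine Tendsto.const_mul _ (tendsto_finsetProd _ fun j _ => (tendsto_coord_mul hτT j).mul ?_)
  have h1 := tendsto_riemannStieltjes_sub_integral (n := fun n : Fin 3 → ℕ => n j)
    (k := fun n => Function.update n 0 ⌊(n 0 : ℝ) * min s s'⌋₊ j) (tendsto_eval_atTop_nat j)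
    (Eventually.of_forall fun n => update_le (floor_mul_le hr.2) j)
    (g := fun _ y => sincKernel (b j) (x j - y) * sincKernel (b j) (x' j - y))
    (fun _ => abs_mul_sub_mul_le (fun y => abs_sincKernel_le (b j) (x j - y))
      (fun y => abs_sincKernel_le (b j) (x' j - y)) (fun y y' =>
        (abs_sincKernel_sub_le _ _ _).trans_eq (by rw [sub_sub_sub_cancel_left, abs_sub_comm]))
      (fun y y' => (abs_sincKernel_sub_le _ _ _).trans_eq
        (by rw [sub_sub_sub_cancel_left, abs_sub_comm])))
    (hT j).le (hτT j) (P := fun v => v) (P' := fun _ => 1) hasDerivAt_id continuous_const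
  simp only [mul_one] at h1
  have h2 : Tendsto (fun n : Fin 3 → ℕ =>
      ((Function.update n 0 ⌊(n 0 : ℝ) * min s s'⌋₊ j : ℕ) : ℝ) / n j) atTop
      (𝓝 (Function.update (1 : Fin 3 → ℝ) 0 (min s s') j)) := by
    rcases eq_or_ne j 0 with rfl | hj
    · simpa using tendsto_floor_mul_div hr.1
    · simp only [Function.update_of_ne hj, Pi.one_apply]
      refine tendsto_const_nhds.congr' ?_
      filter_upwards [eventually_forall_pos] with n hn
      rw [div_self]
      exact_mod_cast (hn j).ne'
  have h3 := ((continuous_covFactor (b j) (T j)).tendsto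
    (Function.update (1 : Fin 3 → ℝ) 0 (min s s') j, x j, x' j)).comp
    (h2.prodMk_nhds (tendsto_const_nhds.prodMk_nhds tendsto_const_nhds))
  have h4 := h1.add h3
  rw [zero_add] at h4
  refine h4.congr fun n => ?_
  simp only [Function.comp_apply, covFactor]
  ring

/-! ## Increments of Brownian motion over the grid -/

/-- Turning the time cut-off into an indicator puts the functionals for different `k` on one index
set. -/
theorem sum_indexBox_update (n : Fin 3 → ℕ) {k : ℕ} (hk : k ≤ n 0) (f : (Fin 3 → ℤ) → ℝ) :
    ∑ l ∈ indexBox (Function.update n 0 k), f l =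
      ∑ l ∈ indexBox n, if l 0 ≤ (k : ℤ) then f l else 0 := by
  rw [← Finset.sum_filter]
  refine Finset.sum_congr ?_ fun _ _ => rfl
  ext l
  simp only [Finset.mem_filter, indexBox, Fintype.mem_piFinset, Finset.mem_Icc]
  constructor
  · exact fun h => ⟨fun j => ⟨(h j).1, (h j).2.trans (by exact_mod_cast update_le hk j)⟩,
      by simpa using (h 0).2⟩
  · intro h j
    rcases eq_or_ne j 0 with rfl | hj
    · simpa using ⟨(h.1 0).1, h.2⟩
    · simpa [hj] using h.1 j

theorem coe_gridPoint {n : Fin 3 → ℕ} {l : Fin 3 → ℤ} {j : Fin 3} (h0 : 0 ≤ l j)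
    (hn : l j ≤ n j) : (gridPoint n l j : ℝ) = l j / n j := coe_projIcc_div h0 hn

theorem gridPoint_mono (n : Fin 3 → ℕ) {l l' : Fin 3 → ℤ} {j : Fin 3} (h : l j ≤ l' j) :
    gridPoint n l j ≤ gridPoint n l' j := by
  refine Set.monotone_projIcc _ ?_
  have : (l j : ℝ) ≤ l' j := by exact_mod_cast h
  gcongr

theorem disjoint_block_gridPoint (n : Fin 3 → ℕ) {l l' : Fin 3 → ℤ} (hne : l ≠ l') :
    Disjoint (block (gridPoint n (l - 1)) (gridPoint n l))
      (block (gridPoint n (l' - 1)) (gridPoint n l')) := by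
  have key : ∀ l l' : Fin 3 → ℤ, ∀ j, l j < l' j → ∀ v, v ∈ block (gridPoint n (l - 1))
      (gridPoint n l) → v ∈ block (gridPoint n (l' - 1)) (gridPoint n l') → False := by
    intro l l' j hj v hv hv'
    have h1 := (hv j trivial).2
    have h2 := (hv' j trivial).1
    have h3 : gridPoint n l j ≤ gridPoint n (l' - 1) j := gridPoint_mono n (by simp; omega)
    exact absurd (h1.trans h3) (not_le.2 h2)
  obtain ⟨j, hj⟩ := Function.ne_iff.1 hne
  rw [Set.disjoint_left]
  intro v hv hv'
  rcases lt_or_gt_of_ne hj with h | h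
  · exact key l l' j h v hv hv'
  · exact key l' l j h v hv' hv

section Brownian

variable {Ω : Type*} [MeasurableSpace Ω] {P : Measure Ω} {B : Ω → SkorohodSpace 3}

theorem IsBrownianSheet.hasLaw_grid (hB : IsBrownianSheet (fun ω => (B ω : (Fin 3 → I) → ℝ)) P)
    {n : Fin 3 → ℕ} {l : Fin 3 → ℤ} (hl : l ∈ indexBox n) :
    HasLaw (fun ω => boxIncrement (B ω) (gridPoint n (l - 1)) (gridPoint n l))
      (gaussianReal 0 (∏ j, (n j : ℝ≥0)⁻¹)) P := by
  have hl' : ∀ j, 1 ≤ l j ∧ l j ≤ n j := by simpa [indexBox, Fintype.mem_piFinset] using hl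
  have h := hB.increments_law (gridPoint n (l - 1)) (gridPoint n l)
    fun j => gridPoint_mono n (by simp)
  have e : ∏ j, Real.toNNReal ((gridPoint n l j : ℝ) - gridPoint n (l - 1) j) =
      ∏ j, (n j : ℝ≥0)⁻¹ := by
    refine Finset.prod_congr rfl fun j _ => ?_
    have := hl' j
    rw [coe_gridPoint (by omega) (by omega), coe_gridPoint (by simp; omega) (by simp; omega),
      ← sub_div]
    simp [Real.toNNReal_inv]
  rw [e] at h
  exact h

theorem IsBrownianSheet.iIndepFun_grid
    (hB : IsBrownianSheet (fun ω => (B ω : (Fin 3 → I) → ℝ)) P) (n : Fin 3 → ℕ) :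
    iIndepFun (fun (l : indexBox n) ω =>
      boxIncrement (B ω) (gridPoint n (l.1 - 1)) (gridPoint n l.1)) P := by
  have h := hB.increments_indep (indexBox n).card
    (fun i => gridPoint n (((indexBox n).equivFin.symm i).1 - 1))
    (fun i => gridPoint n ((indexBox n).equivFin.symm i).1)
    (fun i j => gridPoint_mono n (by simp))
    (fun i i' hne => disjoint_block_gridPoint n fun he =>
      hne ((indexBox n).equivFin.symm.injective (Subtype.ext he)))
  have h' := h.precomp (indexBox n).equivFin.injective
  simpa only [Equiv.symm_apply_apply, alternatingSum_eq_boxIncrement] using h'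

theorem IsBrownianSheet.hasLaw_gridSum [IsProbabilityMeasure P] {ι : Type*} [Fintype ι]
    (hB : IsBrownianSheet (fun ω => (B ω : (Fin 3 → I) → ℝ)) P)
    (b : Fin 3 → ℝ) {τ : Fin 3 → ℕ → ℝ} (hτ : ∀ j m, 0 < m → 0 < τ j m) (sig : ℝ) {n : Fin 3 → ℕ}
    (hn : ∀ j, 0 < n j) (a : ι → ℝ) (k : ι → ℕ) (hk : ∀ i, k i ≤ n 0) (x : ι → Fin 3 → ℝ) :
    HasLaw (fun ω => ∑ i, a i * gridSum b τ n (fun v => sig * B ω v) (k i) (x i))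
      (gaussianReal 0 (∑ i, ∑ i', a i * a i' *
        gridCov b τ sig n (min (k i) (k i')) (x i) (x i')).toNNReal) P := by
  set R : ℝ := √(∏ j, (n j * τ j (n j))) with hR
  set G : (Fin 3 → ℤ) → ℝ := fun l => sig * R * ∑ i, a i * (if l 0 ≤ (k i : ℤ) then
    reconstructionKernel b (x i - samplePoint τ n l) else 0) with hG
  have h := hasLaw_gaussianReal_linearCombination
    (X := fun (l : indexBox n) ω => boxIncrement (B ω) (gridPoint n (l.1 - 1)) (gridPoint n l.1))
    (v := fun _ => ∏ j, (n j : ℝ≥0)⁻¹) (fun l => hB.hasLaw_grid l.2) (hB.iIndepFun_grid n)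
    (fun l => G l)
  have e1 : ∀ ω, ∑ i, a i * gridSum b τ n (fun v => sig * B ω v) (k i) (x i) =
      ∑ l : indexBox n, G l * boxIncrement (B ω) (gridPoint n (l.1 - 1)) (gridPoint n l.1) := by
    intro ω
    rw [Finset.sum_coe_sort (indexBox n) fun l =>
      G l * boxIncrement (B ω) (gridPoint n (l - 1)) (gridPoint n l)]
    simp only [gridSum_const_mul]
    simp only [gridSum, sum_indexBox_update n (hk _), hG, Finset.mul_sum, Finset.sum_mul]
    rw [Finset.sum_comm]
    refine Finset.sum_congr rfl fun l _ => Finset.sum_congr rfl fun i _ => ?_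
    split_ifs
    · ring
    · ring
  have e2 : ∑ l : indexBox n, G l ^ 2 * ((∏ j, (n j : ℝ≥0)⁻¹ : ℝ≥0) : ℝ) =
      ∑ i, ∑ i', a i * a i' * gridCov b τ sig n (min (k i) (k i')) (x i) (x i') := by
    rw [Finset.sum_coe_sort (indexBox n) fun l => G l ^ 2 * ((∏ j, (n j : ℝ≥0)⁻¹ : ℝ≥0) : ℝ)]
    have hR2 : R ^ 2 = ∏ j, (n j * τ j (n j)) := Real.sq_sqrt
      (Finset.prod_nonneg fun j _ => mul_nonneg (Nat.cast_nonneg _) (hτ j _ (hn j)).le)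
    have hcov : ∀ i i', gridCov b τ sig n (min (k i) (k i')) (x i) (x i') =
        ∑ l ∈ indexBox n, sig ^ 2 * R ^ 2 *
          ((if l 0 ≤ (k i : ℤ) then reconstructionKernel b (x i - samplePoint τ n l) else 0) *
          (if l 0 ≤ (k i' : ℤ) then reconstructionKernel b (x i' - samplePoint τ n l) else 0)) *
          ∏ j, (n j : ℝ)⁻¹ := by
      intro i i'
      rw [gridCov, Finset.prod_mul_distrib, ← hR2, ← sum_indexBox_prod (Function.update n 0 _)
        (fun j l => sincKernel (b j) (x i j - l * τ j (n j)) *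
          sincKernel (b j) (x i' j - l * τ j (n j)) * ((l : ℝ) / n j - ((l : ℝ) - 1) / n j)),
        sum_indexBox_update n ((min_le_left _ _).trans (hk i)), ← mul_assoc, Finset.mul_sum]
      refine Finset.sum_congr rfl fun l _ => ?_
      have hd : ∀ j, ((l j : ℝ) / n j - ((l j : ℝ) - 1) / n j) = (n j : ℝ)⁻¹ := fun j => by
        rw [← sub_div]
        simp
      simp only [hd, Finset.prod_mul_distrib, reconstructionKernel_eq_prod, Nat.cast_min, le_min_iff,
        samplePoint, Pi.sub_apply]
      by_cases h1 : l 0 ≤ (k i : ℤ) <;> by_cases h2 : l 0 ≤ (k i' : ℤ) <;> simp [h1, h2]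
      ring
    simp only [hcov, Finset.mul_sum]
    rw [Finset.sum_congr rfl fun i _ => Finset.sum_comm, Finset.sum_comm]
    refine Finset.sum_congr rfl fun l _ => ?_
    rw [hG]
    simp only [sq (∑ i, _), Finset.mul_sum, Finset.sum_mul]
    refine Finset.sum_congr rfl fun i _ => Finset.sum_congr rfl fun i' _ => ?_
    push_cast
    ring
  rw [e2] at h
  simpa only [e1] using h

end Brownian

/-! ## The limit process -/

section Existence

variable {Ω : Type*} [MeasurableSpace Ω] {P : Measure Ω} [IsProbabilityMeasure P]
  {B : Ω → SkorohodSpace 3} {b : Fin 3 → ℝ} {τ : Fin 3 → ℕ → ℝ} {T : Fin 3 → ℝ}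

/-- Arbitrary linear combinations are treated at once because joint Gaussianity is tested on them.
-/
theorem IsBrownianSheet.hasLaw_limitFunctional {ι : Type*} [Fintype ι]
    (hB : IsBrownianSheet (fun ω => (B ω : (Fin 3 → I) → ℝ)) P)
    (b : Fin 3 → ℝ) (hτ : ∀ j m, 0 < m → 0 < τ j m) (hT : ∀ j, 0 < T j)
    (hτT : ∀ j, Tendsto (fun m : ℕ => (m : ℝ) * τ j m) atTop (𝓝 (T j))) (sig : ℝ) (a : ι → ℝ)
    (s : ι → ℝ) (hs : ∀ i, s i ∈ Set.Icc (0 : ℝ) 1) (x : ι → Fin 3 → ℝ)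
    (hx : ∀ i, x i ∈ Set.Icc 0 T) :
    HasLaw (fun ω => ∑ i, a i * limitFunctional b τ (fun v => sig * B ω v) (s i) (x i))
      (gaussianReal 0 (∑ i, ∑ i', a i * a i' *
        limitCov b T sig (s i) (x i) (s i') (x i')).toNNReal) P := by
  refine hasLaw_gaussianReal_of_tendsto (l := (atTop : Filter (Fin 3 → ℕ)))
    (Y := fun n ω => ∑ i, a i * gridSum b τ n (fun v => sig * B ω v) ⌊(n 0 : ℝ) * s i⌋₊ (x i))
    (v := fun n => ∑ i, ∑ i', a i * a i' * gridCov b τ sig n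
      (min ⌊(n 0 : ℝ) * s i⌋₊ ⌊(n 0 : ℝ) * s i'⌋₊) (x i) (x i')) ?_ ?_ ?_
  · filter_upwards [eventually_forall_pos] with n hn
    exact hB.hasLaw_gridSum b hτ sig hn a _ (fun i => floor_mul_le (hs i).2) x
  · filter_upwards [hB.continuous_paths] with ω hω
    have h := isGridLimit_limitFunctional b hτ hT hτT (w := fun v => sig * B ω v)
      (continuous_const.mul hω)
    exact tendsto_finsetSum _ fun i _ => (h.tendsto_floor (hs i) (hx i)).const_mul (a i)
  · exact tendsto_finsetSum _ fun i _ => tendsto_finsetSum _ fun i' _ =>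
      (tendsto_gridCov b hT hτT sig (hs i) (hs i') (x i) (x i')).const_mul _

theorem strongDual_apply_eq_sum {ι : Type*} [Fintype ι] [DecidableEq ι] (L : (ι → ℝ) →L[ℝ] ℝ)
    (y : ι → ℝ) : L y = ∑ i, L (Pi.single i 1) * y i := by
  conv_lhs => rw [← Finset.univ_sum_single y]
  rw [map_sum]
  refine Finset.sum_congr rfl fun i _ => ?_
  have : (Pi.single i (y i) : ι → ℝ) = y i • Pi.single i (1 : ℝ) := by
    rw [← Pi.single_smul, smul_eq_mul, mul_one]
  rw [this, map_smul, smul_eq_mul, mul_comm]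

theorem IsBrownianSheet.isLimitProcess
    (hB : IsBrownianSheet (fun ω => (B ω : (Fin 3 → I) → ℝ)) P)
    (b : Fin 3 → ℝ) (hτ : ∀ j m, 0 < m → 0 < τ j m) (hT : ∀ j, 0 < T j)
    (hτT : ∀ j, Tendsto (fun m : ℕ => (m : ℝ) * τ j m) atTop (𝓝 (T j))) (sig : ℝ) {s₀ : ℝ}
    (hs₀ : 0 < s₀) :
    IsLimitProcess b T sig s₀
      (fun s x ω => limitFunctional b τ (fun v => sig * B ω v) s x) P := by
  classical
  have hIcc : ∀ s ∈ Set.Icc s₀ 1, s ∈ Set.Icc (0 : ℝ) 1 := fun s hs => ⟨hs₀.le.trans hs.1, hs.2⟩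
  set F : ℝ → (Fin 3 → ℝ) → Ω → ℝ :=
    fun s x ω => limitFunctional b τ (fun v => sig * B ω v) s x with hF
  have hone : ∀ s ∈ Set.Icc s₀ 1, ∀ x ∈ Set.Icc 0 T,
      HasLaw (F s x) (gaussianReal 0 (limitCov b T sig s x s x).toNNReal) P := by
    intro s hs x hx
    simpa using hB.hasLaw_limitFunctional b hτ hT hτT sig (fun _ : Unit => 1) (fun _ => s)
      (fun _ => hIcc s hs) (fun _ => x) (fun _ => hx)
  refine ⟨⟨fun J => ⟨?_⟩⟩, ?_, ?_, ?_⟩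
  · have hm : AEMeasurable (fun ω => J.restrict fun p :
        (Set.Icc s₀ 1 ×ˢ Set.Icc 0 T : Set (ℝ × (Fin 3 → ℝ))) => F p.1.1 p.1.2 ω) P :=
      aemeasurable_pi_lambda _ fun p => (hone _ p.1.2.1 _ p.1.2.2).aemeasurable
    refine isGaussian_of_map_eq_gaussianReal fun L => ⟨0,
      (∑ i : J, ∑ i' : J, L (Pi.single i 1) * L (Pi.single i' 1) *
        limitCov b T sig i.1.1.1 i.1.1.2 i'.1.1.1 i'.1.1.2).toNNReal, ?_⟩
    rw [AEMeasurable.map_map_of_aemeasurable (by fun_prop) hm]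
    have h := (hB.hasLaw_limitFunctional b hτ hT hτT sig (fun i : J => L (Pi.single i 1))
      (fun i => i.1.1.1) (fun i => hIcc _ i.1.2.1) (fun i => i.1.1.2) (fun i => i.1.2.2)).map_eq
    rw [← h]
    congr 1
    funext ω
    exact strongDual_apply_eq_sum L _
  · intro s hs x hx
    rw [(hone s hs x hx).integral_eq, integral_id_gaussianReal]
  · intro s hs x hx s' hs' x' hx'
    have hpos : ∀ s ∈ Set.Icc s₀ 1, ∀ x ∈ Set.Icc 0 T, 0 ≤ limitCov b T sig s x s x := by
      intro s hs x _
      rw [limitCov_eq_prod]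
      refine mul_nonneg (sq_nonneg _) (Finset.prod_nonneg fun j _ => mul_nonneg (hT j).le ?_)
      refine intervalIntegral.integral_nonneg ?_ fun v _ => mul_self_nonneg _
      rcases eq_or_ne j 0 with rfl | hj
      · simpa using (hIcc s hs).1
      · simp [hj]
    have hv : ∀ s ∈ Set.Icc s₀ 1, ∀ x ∈ Set.Icc 0 T, Var[F s x; P] = limitCov b T sig s x s x := by
      intro s hs x hx
      rw [(hone s hs x hx).variance_eq, variance_id_gaussianReal, Real.coe_toNNReal _
        (hpos s hs x hx)]
    -- The normal law yields the variance only through `toNNReal`, hence the maximum with 0.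
    -- Polarisation with `c = 1` and `c = -1` then gives two opposite inequalities for the
    -- covariance, so positive semidefiniteness of `limitCov` need not be shown separately.
    have hcomb : ∀ c : ℝ, Var[fun ω => F s x ω + c * F s' x' ω; P] =
        max (limitCov b T sig s x s x + 2 * c * limitCov b T sig s x s' x' +
          c ^ 2 * limitCov b T sig s' x' s' x') 0 := by
      intro c
      have h := hB.hasLaw_limitFunctional b hτ hT hτT sig ![1, c] ![s, s']
        (by simp [Fin.forall_fin_two, hIcc s hs, hIcc s' hs', - Set.mem_Icc]) ![x, x']
        (by simp [Fin.forall_fin_two, hx, hx', - Set.mem_Icc])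
      simp only [Fin.sum_univ_two, Matrix.cons_val_zero, Matrix.cons_val_one, one_mul, mul_one] at h
      rw [h.variance_eq, variance_id_gaussianReal, Real.coe_toNNReal',
        limitCov_comm b T sig s' s x' x]
      congr 1
      ring
    have hL : ∀ s ∈ Set.Icc s₀ 1, ∀ x ∈ Set.Icc 0 T, MemLp (F s x) 2 P := fun s hs x hx =>
      (hone s hs x hx).hasGaussianLaw.memLp_two
    have hvar : ∀ c : ℝ, Var[fun ω => F s x ω + c * F s' x' ω; P] =
        limitCov b T sig s x s x + 2 * c * cov[F s x, F s' x'; P] +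
          c ^ 2 * limitCov b T sig s' x' s' x' := by
      intro c
      rw [variance_fun_add (hL s hs x hx) ((hL s' hs' x' hx').const_mul c), variance_const_mul,
        covariance_const_mul_right, hv s hs x hx, hv s' hs' x' hx']
      ring
    have h1 := (hvar 1).symm.trans (hcomb 1)
    have h2 := (hvar (-1)).symm.trans (hcomb (-1))
    have h1' := le_max_left (limitCov b T sig s x s x + 2 * 1 * limitCov b T sig s x s' x' +
          1 ^ 2 * limitCov b T sig s' x' s' x') 0
    have h2' := le_max_left (limitCov b T sig s x s x + 2 * (-1) * limitCov b T sig s x s' x' +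
          (-1) ^ 2 * limitCov b T sig s' x' s' x') 0
    rw [← h1] at h1'
    rw [← h2] at h2'
    linarith
  · filter_upwards [hB.continuous_paths] with ω hω
    have h := isGridLimit_limitFunctional b hτ hT hτT (w := fun v => sig * B ω v)
      (continuous_const.mul hω)
    exact h.continuousOn.mono (Set.prod_mono hIcc le_rfl)

end Existence

/-! ## Uniqueness in law -/

/-- The characteristic function of a Gaussian vector involves only the means and variances of its
linear functionals. -/
theorem HasGaussianLaw.map_eq_of_moments {Ω Ω' ι : Type*} [MeasurableSpace Ω] [MeasurableSpace Ω']
    {P : Measure Ω} {Q : Measure Ω'} [Fintype ι] {X : ι → Ω → ℝ} {Y : ι → Ω' → ℝ}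
    (hX : HasGaussianLaw (fun ω => (X · ω)) P) (hY : HasGaussianLaw (fun ω => (Y · ω)) Q)
    (hmean : ∀ i, ∫ ω, X i ω ∂P = ∫ ω, Y i ω ∂Q)
    (hcov : ∀ i j, cov[X i, X j; P] = cov[Y i, Y j; Q]) :
    P.map (fun ω => (X · ω)) = Q.map (fun ω => (Y · ω)) := by
  classical
  have := hX.isProbabilityMeasure
  have := hY.isProbabilityMeasure
  have := hX.isGaussian_map
  have := hY.isGaussian_map
  have hXi : ∀ i, HasGaussianLaw (X i) P := fun i => hX.eval i
  have hYi : ∀ i, HasGaussianLaw (Y i) Q := fun i => hY.eval i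
  refine Measure.ext_of_charFunDual (funext fun L => ?_)
  rw [hX.charFunDual_map_eq_fun, hY.charFunDual_map_eq_fun]
  simp only [fun ω => strongDual_apply_eq_sum L (X · ω), fun ω => strongDual_apply_eq_sum L (Y · ω)]
  have e1 : ∫ ω, ∑ i, L (Pi.single i 1) * X i ω ∂P = ∫ ω, ∑ i, L (Pi.single i 1) * Y i ω ∂Q := by
    rw [integral_finsetSum _ fun i _ => (hXi i).integrable.const_mul _,
      integral_finsetSum _ fun i _ => (hYi i).integrable.const_mul _]
    simp only [integral_const_mul, hmean]
  have e2 : Var[fun ω => ∑ i, L (Pi.single i 1) * X i ω; P] =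
      Var[fun ω => ∑ i, L (Pi.single i 1) * Y i ω; Q] := by
    rw [variance_fun_sum fun i => (hXi i).memLp_two.const_mul _,
      variance_fun_sum fun i => (hYi i).memLp_two.const_mul _]
    simp only [covariance_const_mul_left, covariance_const_mul_right, hcov]
  rw [e1, e2]

/-- Both laws are projective limits of the same finite-dimensional laws, and such a limit is unique.
-/
theorem IsGaussianProcess.map_eq_of_moments {Ω Ω' ι : Type*} [MeasurableSpace Ω]
    [MeasurableSpace Ω'] {P : Measure Ω} {Q : Measure Ω'} [Countable ι] {X : ι → Ω → ℝ}
    {Y : ι → Ω' → ℝ} (hX : IsGaussianProcess X P) (hY : IsGaussianProcess Y Q)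
    (hmean : ∀ i, ∫ ω, X i ω ∂P = ∫ ω, Y i ω ∂Q)
    (hcov : ∀ i j, cov[X i, X j; P] = cov[Y i, Y j; Q]) :
    P.map (fun ω => (X · ω)) = Q.map (fun ω => (Y · ω)) := by
  have := hX.isProbabilityMeasure
  have := hY.isProbabilityMeasure
  have hXm : AEMeasurable (fun ω => (X · ω)) P := aemeasurable_pi_lambda _ hX.aemeasurable
  have hYm : AEMeasurable (fun ω => (Y · ω)) Q := aemeasurable_pi_lambda _ hY.aemeasurable
  have h1 := isProjectiveLimit_map hXm
  have h2 := isProjectiveLimit_map hYm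
  have e : (fun J : Finset ι => P.map (fun ω => J.restrict (X · ω))) =
      fun J : Finset ι => Q.map (fun ω => J.restrict (Y · ω)) := by
    funext J
    exact HasGaussianLaw.map_eq_of_moments (X := fun i : J => X i) (Y := fun i : J => Y i)
      (hX.hasGaussianLaw J) (hY.hasGaussianLaw J) (fun i => hmean i) (fun i j => hcov i j)
  rw [e] at h1
  have : ∀ J : Finset ι, IsFiniteMeasure (Q.map (fun ω => J.restrict (Y · ω))) :=
    fun J => inferInstance
  exact h1.unique h2

/-! ## Suprema over the monitored domain -/

/-- The monitored pairs `(s, x)`. -/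
def monitoringDomain (T : Fin 3 → ℝ) (s₀ : ℝ) : Set (ℝ × (Fin 3 → ℝ)) :=
  {p | p.1 ∈ Set.Ioc s₀ 1 ∧ p.2 ∈ monitoringRegion T p.1}

theorem monitoringRegion_subset {T : Fin 3 → ℝ} (hT : ∀ j, 0 < T j) {s : ℝ} (hs : s ≤ 1) :
    monitoringRegion T s ⊆ Set.Icc 0 T := by
  rintro x ⟨h0, h1, h2⟩
  have h0' : x 0 ≤ T 0 := h0.2.trans (mul_le_of_le_one_left (hT 0).le hs)
  refine ⟨fun j => ?_, fun j => ?_⟩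
  · fin_cases j
    exacts [h0.1, h1.1, h2.1]
  · fin_cases j
    exacts [h0', h1.2, h2.2]

theorem monitoringDomain_subset {T : Fin 3 → ℝ} (hT : ∀ j, 0 < T j) (s₀ : ℝ) :
    monitoringDomain T s₀ ⊆ Set.Icc s₀ 1 ×ˢ Set.Icc 0 T := fun _ hp =>
  ⟨⟨hp.1.1.le, hp.1.2⟩, monitoringRegion_subset hT hp.1.2 hp.2⟩

theorem monitoringDomain_nonempty {T : Fin 3 → ℝ} (hT : ∀ j, 0 < T j) {s₀ : ℝ} (hs₀ : s₀ < 1) :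
    (monitoringDomain T s₀).Nonempty :=
  ⟨(1, 0), ⟨hs₀, le_rfl⟩, ⟨le_rfl, by simpa using (hT 0).le⟩, ⟨le_rfl, (hT 1).le⟩,
    ⟨le_rfl, (hT 2).le⟩⟩

theorem iSup_monitoringDomain {T : Fin 3 → ℝ} {s₀ : ℝ} (G : ℝ → (Fin 3 → ℝ) → ℝ≥0∞) :
    ⨆ s ∈ Set.Ioc s₀ 1, ⨆ x ∈ monitoringRegion T s, G s x =
      ⨆ p : monitoringDomain T s₀, G p.1.1 p.1.2 := by
  refine le_antisymm ?_ ?_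
  · exact iSup₂_le fun s hs => iSup₂_le fun x hx =>
      le_iSup (fun p : monitoringDomain T s₀ => G p.1.1 p.1.2) ⟨(s, x), hs, hx⟩
  · exact iSup_le fun p => le_iSup₂_of_le p.1.1 p.2.1 (le_iSup₂_of_le p.1.2 p.2.2 le_rfl)

/-- Path continuity reduces the supremum to countably many coordinates, which gives measurability
and makes it a function of the law of a sequence. -/
theorem iSup_monitoringDomain_eq_iSup_denseRange {T : Fin 3 → ℝ} (hT : ∀ j, 0 < T j) {s₀ : ℝ}
    {f : ℝ → (Fin 3 → ℝ) → ℝ} (hf : ContinuousOn (fun p : ℝ × (Fin 3 → ℝ) => f p.1 p.2)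
      (Set.Icc s₀ 1 ×ˢ Set.Icc 0 T)) {d : ℕ → monitoringDomain T s₀} (hd : DenseRange d) :
    ⨆ s ∈ Set.Ioc s₀ 1, ⨆ x ∈ monitoringRegion T s, ‖f s x‖ₑ =
      ⨆ i, ‖f (d i).1.1 (d i).1.2‖ₑ := by
  rw [iSup_monitoringDomain fun s x => ‖f s x‖ₑ]
  refine le_antisymm (iSup_le fun p => ?_) (iSup_le fun i =>
    le_iSup (fun p : monitoringDomain T s₀ => ‖f p.1.1 p.1.2‖ₑ) (d i))
  have hc : Continuous fun p : monitoringDomain T s₀ => ‖f p.1.1 p.1.2‖ₑ :=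
    ((hf.mono (monitoringDomain_subset hT s₀)).domRestrict).enorm
  refine hd.induction_on (p := fun p : monitoringDomain T s₀ =>
    ‖f p.1.1 p.1.2‖ₑ ≤ ⨆ i, ‖f (d i).1.1 (d i).1.2‖ₑ) p (isClosed_le hc continuous_const) ?_
  exact fun i => le_iSup (fun i => ‖f (d i).1.1 (d i).1.2‖ₑ) i

/-! ## Suprema of Gaussian processes have no atoms -/

theorem measurableSet_isLUB_affine {ι : Type*} [Countable ι] (a : ι → ℝ) (c : ℝ) :
    MeasurableSet {p : (ι → ℝ) × ℝ | IsLUB (Set.range fun i => a i * p.2 + p.1 i) c} := by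
  have e : {p : (ι → ℝ) × ℝ | IsLUB (Set.range fun i => a i * p.2 + p.1 i) c} =
      (⋂ i, {p : (ι → ℝ) × ℝ | a i * p.2 + p.1 i ≤ c}) ∩
      ⋂ m : ℕ, ⋃ i, {p : (ι → ℝ) × ℝ | c - 1 / ((m : ℝ) + 1) < a i * p.2 + p.1 i} := by
    ext p
    simp only [Set.mem_ofPred_eq, Set.mem_inter_iff, Set.mem_iInter, Set.mem_iUnion]
    constructor
    · intro h
      refine ⟨fun i => h.1 ⟨i, rfl⟩, fun m => ?_⟩
      by_contra! hm
      have h1 : c ≤ c - 1 / ((m : ℝ) + 1) := h.2 (by rintro _ ⟨i, rfl⟩; exact hm i)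
      have h2 : 0 < 1 / ((m : ℝ) + 1) := by positivity
      linarith
    · rintro ⟨h1, h2⟩
      refine ⟨by rintro _ ⟨i, rfl⟩; exact h1 i, fun u hu => ?_⟩
      refine le_of_forall_pos_lt_add fun η hη => ?_
      obtain ⟨m, hm⟩ := exists_nat_one_div_lt hη
      obtain ⟨i, hi⟩ := h2 m
      have h3 : a i * p.2 + p.1 i ≤ u := hu ⟨i, rfl⟩
      linarith
  rw [e]
  refine (MeasurableSet.iInter fun i => measurableSet_le (by fun_prop) measurable_const).inter
    (MeasurableSet.iInter fun m => MeasurableSet.iUnion fun i =>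
      measurableSet_lt measurable_const (by fun_prop))

/-- All slopes are at least `δ`, so moving from `t` to a larger `t'` raises the supremum by at least
`δ * (t' - t)`; it meets `c` at most once. -/
theorem subsingleton_setOf_isLUB_affine {ι : Type*} {a : ι → ℝ} {δ : ℝ} (hδ : 0 < δ)
    (ha : ∀ i, δ ≤ a i) (y : ι → ℝ) (c : ℝ) :
    {t : ℝ | IsLUB (Set.range fun i => a i * t + y i) c}.Subsingleton := by
  have key : ∀ t t' : ℝ, IsLUB (Set.range fun i => a i * t + y i) c →
      IsLUB (Set.range fun i => a i * t' + y i) c → ¬ t < t' := by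
    intro t t' h h' hlt
    have hub : c ≤ c - δ * (t' - t) := by
      refine h.2 ?_
      rintro _ ⟨i, rfl⟩
      have h1 : a i * t' + y i ≤ c := h'.1 ⟨i, rfl⟩
      have h2 := mul_le_mul_of_nonneg_right (ha i) (sub_nonneg.2 hlt.le)
      simp only
      linarith
    have := mul_pos hδ (sub_pos.2 hlt)
    linarith
  intro t ht t' ht'
  exact le_antisymm (not_lt.1 (key t' t ht' ht)) (not_lt.1 (key t t' ht ht'))

/-- The supremum of countably many values of a Gaussian process whose covariances with a fixed value
are bounded below by a positive constant has no atoms. -/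
theorem IsGaussianProcess.measure_isLUB_eq_zero {Ω S ι : Type*} [MeasurableSpace Ω]
    {P : Measure Ω} [Countable ι] {X : S → Ω → ℝ} (hX : IsGaussianProcess X P) (p : S) (J : ι → S)
    (hvar : 0 < Var[X p; P]) {δ : ℝ} (hδ : 0 < δ) (hcov : ∀ i, δ ≤ cov[X p, X (J i); P]) (c : ℝ) :
    P {ω | IsLUB (Set.range fun i => X (J i) ω) c} = 0 := by
  classical
  have := hX.isProbabilityMeasure
  -- Regression coefficients on `X p`: the residuals `Y` are uncorrelated with `X p`, hence
  -- independent of it by joint Gaussianity.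
  set a : ι → ℝ := fun i => cov[X p, X (J i); P] / Var[X p; P] with ha
  set Y : ι → Ω → ℝ := fun i ω => X (J i) ω - a i * X p ω with hY
  have hm := hX.aemeasurable
  have hL : ∀ t, MemLp (X t) 2 P := fun t => (hX.hasGaussianLaw_eval t).memLp_two
  have hYm : ∀ i, AEMeasurable (Y i) P := fun i => (hm _).sub ((hm _).const_mul _)
  have hjoint : IsGaussianProcess (Sum.elim (fun _ : Unit => X p) Y) P := by
    refine hX.of_isGaussianProcess ?_
    rintro (_ | i)
    · exact ⟨{p}, ContinuousLinearMap.proj ⟨p, by simp⟩, fun ω => rfl⟩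
    · exact ⟨{J i, p}, ContinuousLinearMap.proj ⟨J i, by simp⟩ -
        a i • ContinuousLinearMap.proj ⟨p, by simp⟩, fun ω => rfl⟩
  have hind := hjoint.indepFun_of_covariance_eq_zero (fun _ => hm p) hYm (by
    intro _ i
    rw [hY, covariance_fun_sub_right (hL p) (hL _) ((hL p).const_mul _), covariance_const_mul_right,
      covariance_self (hm p), ha]
    field_simp
    ring)
  have hind' : IndepFun (fun ω i => Y i ω) (X p) P :=
    (hind.comp (φ := fun f : Unit → ℝ => f ()) (ψ := id) (measurable_pi_apply _)
      measurable_id).symm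
  have hYm' : AEMeasurable (fun ω i => Y i ω) P := aemeasurable_pi_lambda _ hYm
  have hmap := (indepFun_iff_map_prod_eq_prod_map_map hYm' (hm p)).1 hind'
  set A : Set ((ι → ℝ) × ℝ) := {q | IsLUB (Set.range fun i => a i * q.2 + q.1 i) c} with hA
  have hAm : MeasurableSet A := measurableSet_isLUB_affine a c
  have hpre : {ω | IsLUB (Set.range fun i => X (J i) ω) c} =
      (fun ω => ((fun i => Y i ω), X p ω)) ⁻¹' A := by
    ext ω
    simp [hA, hY]
  rw [hpre, ← Measure.map_apply_of_aemeasurable (hYm'.prodMk (hm p)) hAm, hmap]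
  have hprob : IsProbabilityMeasure (P.map (X p)) := Measure.isProbabilityMeasure_map (hm p)
  -- By Fubini, for fixed residuals at most one value of `X p` is admissible, and its nondegenerate
  -- normal law does not charge points.
  rw [Measure.measure_prod_null hAm]
  refine Eventually.of_forall fun y => ?_
  have hsub : (Prod.mk y ⁻¹' A).Subsingleton :=
    subsingleton_setOf_isLUB_affine (δ := δ / Var[X p; P]) (by positivity)
      (fun i => div_le_div_of_nonneg_right (hcov i) hvar.le) y c
  rw [(hX.hasGaussianLaw_eval p).map_eq_gaussianReal]
  have := nullSingletonClass_gaussianReal (μ := P[X p]) (v := Var[X p; P].toNNReal)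
    (Real.toNNReal_pos.2 hvar).ne'
  exact hsub.measure_zero _

theorem isCompact_closed_monitoringDomain {T : Fin 3 → ℝ} (hT : ∀ j, 0 < T j) (s₀ : ℝ) :
    IsCompact {p : ℝ × (Fin 3 → ℝ) | p.1 ∈ Set.Icc s₀ 1 ∧ p.2 ∈ monitoringRegion T p.1} := by
  refine (isCompact_Icc.prod isCompact_Icc : IsCompact (Set.Icc s₀ 1 ×ˢ Set.Icc 0 T)).of_isClosed_subset
    ?_ fun p hp => ⟨hp.1, monitoringRegion_subset hT hp.1.2 hp.2⟩
  simp only [monitoringRegion, Set.mem_Icc, Set.ofPred_and]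
  refine IsClosed.inter (IsClosed.inter ?_ ?_) (IsClosed.inter (IsClosed.inter ?_ ?_)
    (IsClosed.inter (IsClosed.inter ?_ ?_) (IsClosed.inter ?_ ?_))) <;>
  exact isClosed_le (by fun_prop) (by fun_prop)

/-- The supremum of the absolute value of the limit process has no positive atoms. -/
theorem IsLimitProcess.measure_iSup_eq_zero {Ω : Type*} [MeasurableSpace Ω] {P : Measure Ω}
    {b T : Fin 3 → ℝ} {sig s₀ : ℝ} {F : ℝ → (Fin 3 → ℝ) → Ω → ℝ}
    (hF : IsLimitProcess b T sig s₀ F P) (hb : ∀ j, 0 < b j) (hT : ∀ j, 0 < T j) (hsig : 0 < sig)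
    (hs₀ : 0 < s₀) {c : ℝ} (hc : 0 < c) (d : ℕ → monitoringDomain T s₀) :
    P {ω | ⨆ i, ‖F (d i).1.1 (d i).1.2 ω‖ₑ = ENNReal.ofReal c} = 0 := by
  set K := {p : ℝ × (Fin 3 → ℝ) | p.1 ∈ Set.Icc s₀ 1 ∧ p.2 ∈ monitoringRegion T p.1} with hK
  -- On `U p` the covariance with the value at `p` exceeds half the variance at `p`. The domain `K`
  -- is closed at `s₀` to be compact, so finitely many `U p` suffice.
  set U : ℝ × (Fin 3 → ℝ) → Set (ℝ × (Fin 3 → ℝ)) := fun p =>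
    {q | limitCov b T sig p.1 p.2 p.1 p.2 / 2 < limitCov b T sig p.1 p.2 q.1 q.2} with hU
  have hvar : ∀ p ∈ K, 0 < limitCov b T sig p.1 p.2 p.1 p.2 := fun p hp =>
    limitCov_self_pos hb hT hsig (hs₀.trans_le hp.1.1) hp.2
  have hUn : ∀ p ∈ K, U p ∈ 𝓝 p := by
    intro p hp
    have hcont : Continuous fun q : ℝ × (Fin 3 → ℝ) => limitCov b T sig p.1 p.2 q.1 q.2 :=
      (continuous_limitCov b T sig).comp (g := fun y : (ℝ × (Fin 3 → ℝ)) × (ℝ × (Fin 3 → ℝ)) =>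
        limitCov b T sig y.1.1 y.1.2 y.2.1 y.2.2) (f := fun q => (p, q)) (by fun_prop)
    have h := hcont.continuousAt (x := p)
    exact h.eventually_const_lt (half_lt_self (hvar p hp))
  obtain ⟨t, htK, ht⟩ := (isCompact_closed_monitoringDomain hT s₀).elim_nhds_subcover U hUn
  have hKsub : ∀ p ∈ K, p ∈ Set.Icc s₀ 1 ×ˢ Set.Icc 0 T := fun p hp =>
    ⟨hp.1, monitoringRegion_subset hT hp.1.2 hp.2⟩
  have hdK : ∀ i, (d i).1 ∈ K := fun i => ⟨⟨(d i).2.1.1.le, (d i).2.1.2⟩, (d i).2.2⟩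
  have hnull : ∀ e : ℝ, e * e = 1 → ∀ p ∈ t, P {ω | IsLUB (Set.range
      fun i : {i // (d i).1 ∈ U p} => e * F (d i.1).1.1 (d i.1).1.2 ω) c} = 0 := by
    intro e he p hp
    have hp' := hKsub p (htK p hp)
    have hX := hF.gaussian.smul fun _ => e
    refine IsGaussianProcess.measure_isLUB_eq_zero (X := fun (q :
      (Set.Icc s₀ 1 ×ˢ Set.Icc 0 T : Set (ℝ × (Fin 3 → ℝ)))) ω => e * F q.1.1 q.1.2 ω) hX ⟨p, hp'⟩
      (fun i : {i // (d i).1 ∈ U p} => ⟨(d i.1).1, hKsub _ (hdK i.1)⟩)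
      (δ := limitCov b T sig p.1 p.2 p.1 p.2 / 2) ?_ (half_pos (hvar p (htK p hp))) ?_ c
    · rw [variance_const_mul, sq, he, one_mul, ← covariance_self (hF.gaussian.aemeasurable ⟨p, hp'⟩),
        hF.covariance _ hp'.1 _ hp'.2 _ hp'.1 _ hp'.2]
      exact hvar p (htK p hp)
    · intro i
      have hi := hKsub _ (hdK i.1)
      rw [covariance_const_mul_left, covariance_const_mul_right, ← mul_assoc, he, one_mul,
        hF.covariance _ hp'.1 _ hp'.2 _ hi.1 _ hi.2]
      exact i.2.le
  -- If neither `F` nor `-F` had supremum exactly `c` on some piece of the cover, `|F|` would be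
  -- bounded on each piece by a number below `c`; the largest of these finitely many bounds would
  -- keep the whole supremum below `c`.
  have hsub : {ω | ⨆ i, ‖F (d i).1.1 (d i).1.2 ω‖ₑ = ENNReal.ofReal c} ⊆
      ⋃ p ∈ t, ({ω | IsLUB (Set.range
        fun i : {i // (d i).1 ∈ U p} => 1 * F (d i.1).1.1 (d i.1).1.2 ω) c} ∪
      {ω | IsLUB (Set.range
        fun i : {i // (d i).1 ∈ U p} => (-1) * F (d i.1).1.1 (d i.1).1.2 ω) c}) := by
    intro ω hω
    rw [Set.mem_ofPred_eq] at hω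
    by_contra hcon
    simp only [Set.mem_iUnion, Set.mem_union, Set.mem_ofPred_eq, not_exists, not_or] at hcon
    have hle : ∀ i, |F (d i).1.1 (d i).1.2 ω| ≤ c := by
      intro i
      have h := (le_iSup (fun i => ‖F (d i).1.1 (d i).1.2 ω‖ₑ) i).trans hω.le
      rwa [← ofReal_norm, ENNReal.ofReal_le_ofReal_iff hc.le, Real.norm_eq_abs] at h
    have hbound : ∀ e : ℝ, e = 1 ∨ e = -1 → ∀ p ∈ t, ∃ u < c, ∀ i, (d i).1 ∈ U p →
        e * F (d i).1.1 (d i).1.2 ω ≤ u := by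
      intro e he p hp
      have hnot : ¬ IsLUB (Set.range
          fun i : {i // (d i).1 ∈ U p} => e * F (d i.1).1.1 (d i.1).1.2 ω) c := by
        rcases he with rfl | rfl
        exacts [(hcon p hp).1, (hcon p hp).2]
      by_contra! hall
      refine hnot ⟨?_, fun u hu => ?_⟩
      · rintro _ ⟨i, rfl⟩
        have := abs_le.1 (hle i.1)
        rcases he with rfl | rfl <;> simp <;> linarith [this.1, this.2]
      · by_contra! huc
        obtain ⟨i, hi, hi'⟩ := hall u huc
        exact absurd (hu ⟨⟨i, hi⟩, rfl⟩) (not_le.2 hi')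
    have hb1 : ∀ p ∈ t, ∃ u < c, ∀ i, (d i).1 ∈ U p → |F (d i).1.1 (d i).1.2 ω| ≤ u := by
      intro p hp
      obtain ⟨u, hu, hu'⟩ := hbound 1 (Or.inl rfl) p hp
      obtain ⟨w, hw, hw'⟩ := hbound (-1) (Or.inr rfl) p hp
      refine ⟨max u w, max_lt hu hw, fun i hi => abs_le.2 ⟨?_, ?_⟩⟩
      · have := hw' i hi
        have := le_max_right u w
        linarith
      · have := hu' i hi
        have := le_max_left u w
        linarith
    choose! u hu hu' using hb1
    obtain ⟨p0, hp0, -⟩ := Set.mem_iUnion₂.1 (ht (hdK 0))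
    set u₀ := t.sup' ⟨p0, hp0⟩ u with hu₀
    have hu₀c : u₀ < c := (Finset.sup'_lt_iff _).2 hu
    have hle' : ⨆ i, ‖F (d i).1.1 (d i).1.2 ω‖ₑ ≤ ENNReal.ofReal u₀ := by
      refine iSup_le fun i => ?_
      obtain ⟨p, hp, hpi⟩ := Set.mem_iUnion₂.1 (ht (hdK i))
      rw [← ofReal_norm, Real.norm_eq_abs]
      exact ENNReal.ofReal_le_ofReal ((hu' p hp i hpi).trans (Finset.le_sup' u hp))
    rw [hω, ENNReal.ofReal_le_ofReal_iff'] at hle'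
    rcases hle' with h | h <;> linarith
  refine measure_mono_null hsub ?_
  refine (measure_biUnion_null_iff (μ := P) t.countable_toSet).2
    fun p hp => ?_
  exact measure_union_null (hnull 1 (by norm_num) p hp) (hnull (-1) (by norm_num) p hp)

/-! ## The law of the supremum -/

theorem IsLimitProcess.measure_lt_iSup {Ω Ω' : Type*} [MeasurableSpace Ω] [MeasurableSpace Ω']
    {P : Measure Ω} {Q : Measure Ω'} {b T : Fin 3 → ℝ} {sig s₀ : ℝ} {F : ℝ → (Fin 3 → ℝ) → Ω → ℝ}
    {G : ℝ → (Fin 3 → ℝ) → Ω' → ℝ} (hF : IsLimitProcess b T sig s₀ F P)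
    (hG : IsLimitProcess b T sig s₀ G Q) (hT : ∀ j, 0 < T j) (d : ℕ → monitoringDomain T s₀)
    (C : ℝ≥0∞) :
    P {ω | C < ⨆ i, ‖F (d i).1.1 (d i).1.2 ω‖ₑ} = Q {ω | C < ⨆ i, ‖G (d i).1.1 (d i).1.2 ω‖ₑ} := by
  set D : ℕ → (Set.Icc s₀ 1 ×ˢ Set.Icc 0 T : Set (ℝ × (Fin 3 → ℝ))) :=
    fun i => ⟨(d i).1, monitoringDomain_subset hT s₀ (d i).2⟩
  have hX := hF.gaussian.comp_right D
  have hY := hG.gaussian.comp_right D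
  have hmap := IsGaussianProcess.map_eq_of_moments hX hY
    (fun i => (hF.mean_zero _ (D i).2.1 _ (D i).2.2).trans
      (hG.mean_zero _ (D i).2.1 _ (D i).2.2).symm)
    (fun i j => (hF.covariance _ (D i).2.1 _ (D i).2.2 _ (D j).2.1 _ (D j).2.2).trans
      (hG.covariance _ (D i).2.1 _ (D i).2.2 _ (D j).2.1 _ (D j).2.2).symm)
  have hXm := aemeasurable_pi_lambda _ hX.aemeasurable
  have hYm := aemeasurable_pi_lambda _ hY.aemeasurable
  have hS : MeasurableSet {y : ℕ → ℝ | C < ⨆ i, ‖y i‖ₑ} :=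
    measurableSet_lt measurable_const (Measurable.iSup fun i => (measurable_pi_apply i).enorm)
  have h := congrFun (congrArg DFunLike.coe hmap) {y : ℕ → ℝ | C < ⨆ i, ‖y i‖ₑ}
  rwa [Measure.map_apply_of_aemeasurable hXm hS, Measure.map_apply_of_aemeasurable hYm hS] at h

/-! ## An extended continuous mapping theorem -/

theorem exists_nat_of_eventually_atTop {p : (Fin 3 → ℕ) → Prop} (h : ∀ᶠ n in atTop, p n) :
    ∃ N : ℕ, ∀ n : Fin 3 → ℕ, (∀ j, N ≤ n j) → p n := by
  obtain ⟨N, hN⟩ := eventually_atTop.1 h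
  exact ⟨Finset.univ.sup N, fun n hn => hN n fun j =>
    (Finset.le_sup (f := N) (Finset.mem_univ j)).trans (hn j)⟩

/-- The closure of the union of the sets `E n` with all `n j ≥ N`. -/
def tailClosure {X : Type*} [TopologicalSpace X] (E : (Fin 3 → ℕ) → Set X) (N : ℕ) : Set X :=
  closure (⋃ n ∈ {n : Fin 3 → ℕ | ∀ j, N ≤ n j}, E n)

theorem antitone_tailClosure {X : Type*} [TopologicalSpace X] (E : (Fin 3 → ℕ) → Set X) :
    Antitone (tailClosure E) := fun _ _ h =>
  closure_mono (Set.biUnion_mono (fun _ hn j => h.trans (hn j)) fun _ _ => subset_rfl)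

section ContinuousMapping

variable {Ω Ω' X : Type*} [MeasurableSpace Ω] [MeasurableSpace Ω'] {P : Measure Ω}
  [IsProbabilityMeasure P] {P' : Measure Ω'} [IsProbabilityMeasure P'] [PseudoEMetricSpace X]
  [MeasurableSpace X] [BorelSpace X] {Z : (Fin 3 → ℕ) → Ω → X} {Z₀ : Ω' → X}
  {E : (Fin 3 → ℕ) → Set X} {D : Set Ω'}

/-- `E n` lies in the closed set `tailClosure E N` once all `n j ≥ N`. The portmanteau theorem
bounds the limsup for each `N`, and continuity from above lets `N` grow. -/
theorem eventually_measure_preimage_lt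
    (hZ : TendstoInDistribution Z atTop Z₀ (fun _ => P) P')
    (h : ∀ᵐ ω ∂P', (∀ N, Z₀ ω ∈ tailClosure E N) → ω ∈ D) {a : ℝ≥0∞} (ha : P' D < a) :
    ∀ᶠ n in atTop, P (Z n ⁻¹' E n) < a := by
  have hcl : ∀ N, IsClosed (tailClosure E N) := fun N => isClosed_closure
  have hlim : Tendsto (fun N => P' (Z₀ ⁻¹' tailClosure E N)) atTop
      (𝓝 (P' (⋂ N, Z₀ ⁻¹' tailClosure E N))) :=
    tendsto_measure_iInter_atTop
      (fun N => hZ.aemeasurable_limit.nullMeasurableSet_preimage (hcl N).measurableSet)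
      (fun _ _ hN => Set.preimage_mono (antitone_tailClosure E hN)) ⟨0, measure_ne_top _ _⟩
  have hle : P' (⋂ N, Z₀ ⁻¹' tailClosure E N) ≤ P' D := by
    refine measure_mono_ae ?_
    filter_upwards [h] with ω hω hmem
    exact hω fun N => Set.mem_iInter.1 hmem N
  obtain ⟨N, hN⟩ := (hlim.eventually_lt_const (hle.trans_lt ha)).exists
  have hport := ProbabilityMeasure.limsup_measure_closed_le_of_tendsto hZ.tendsto (hcl N)
  simp only [ProbabilityMeasure.coe_mk] at hport
  rw [Measure.map_apply_of_aemeasurable hZ.aemeasurable_limit (hcl N).measurableSet] at hport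
  have hev := eventually_lt_of_limsup_lt (hport.trans_lt hN)
  filter_upwards [hev, eventually_ge_atTop (fun _ => N)] with n hn hNn
  rw [Measure.map_apply_of_aemeasurable (hZ.forall_aemeasurable n) (hcl N).measurableSet] at hn
  refine (measure_mono (Set.preimage_mono ?_)).trans_lt hn
  exact (Set.subset_biUnion_of_mem (u := fun n => E n) (show n ∈ {n : Fin 3 → ℕ | ∀ j, N ≤ n j}
    from fun j => hNn j)).trans subset_closure

/-- The upper bound is used twice, for `E` and for its complements. -/
theorem tendsto_measure_preimage
    (hZ : TendstoInDistribution Z atTop Z₀ (fun _ => P) P') (hD : NullMeasurableSet D P')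
    (h : ∀ᵐ ω ∂P', (∀ N, Z₀ ω ∈ tailClosure E N) → ω ∈ D)
    (h' : ∀ᵐ ω ∂P', (∀ N, Z₀ ω ∈ tailClosure (fun n => (E n)ᶜ) N) → ω ∉ D) :
    Tendsto (fun n => P (Z n ⁻¹' E n)) atTop (𝓝 (P' D)) := by
  refine tendsto_order.2 ⟨fun a ha => ?_, fun a ha => eventually_measure_preimage_lt hZ h ha⟩
  have ha' : P' Dᶜ < 1 - a := by
    rw [lt_tsub_iff_left]
    calc a + P' Dᶜ < P' D + P' Dᶜ := ENNReal.add_lt_add_right (measure_ne_top _ _) ha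
      _ = 1 := by rw [measure_add_measure_compl₀ hD, measure_univ]
  filter_upwards [eventually_measure_preimage_lt hZ h' ha'] with n hn
  by_contra! hle
  -- The sets `E n` are not assumed measurable, so only subadditivity is used.
  have h1 : (1 : ℝ≥0∞) ≤ P (Z n ⁻¹' E n) + P (Z n ⁻¹' (E n)ᶜ) := by
    rw [← measure_univ (μ := P), ← Set.union_compl_self (Z n ⁻¹' E n)]
    exact measure_union_le _ _
  have h2 : P (Z n ⁻¹' E n) + P (Z n ⁻¹' (E n)ᶜ) < a + (1 - a) :=
    ENNReal.add_lt_add_of_le_of_lt (measure_ne_top _ _) hle hn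
  have h3 : a ≤ 1 := ha.le.trans prob_le_one
  rw [add_tsub_cancel_of_le h3] at h2
  exact absurd h2 (not_lt.2 h1)

end ContinuousMapping

/-! ## The exceedance event -/

/-- In a Skorohod neighbourhood of a continuous function, functions are uniformly close to it. -/
theorem exists_forall_edist_lt_abs_sub_le {q : ℕ} {z : SkorohodSpace q}
    (hz : Continuous (z : (Fin q → I) → ℝ)) {δ : ℝ} (hδ : 0 < δ) :
    ∃ η : ℝ≥0∞, 0 < η ∧ ∀ w : SkorohodSpace q, edist w z < η → ∀ v, |w v - z v| ≤ δ := by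
  have huc := CompactSpace.uniformContinuous_of_continuous hz
  obtain ⟨ρ, hρ, hρ'⟩ := Metric.uniformContinuous_iff.1 huc (δ / 2) (half_pos hδ)
  refine ⟨min (ENNReal.ofReal (δ / 2)) (ENNReal.ofReal ρ),
    lt_min (ENNReal.ofReal_pos.2 (half_pos hδ)) (ENNReal.ofReal_pos.2 hρ), fun w hw v => ?_⟩
  obtain ⟨lam, hlam⟩ := iInf_lt_iff.1 (show skorohodDist w z < _ from hw)
  have h1 : edist (w v) (z (timeChange lam v)) < ENNReal.ofReal (δ / 2) :=
    ((le_iSup (fun t => edist (w t) (z (timeChange lam t))) v).trans (le_max_left _ _)).trans_lt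
      (hlam.trans_le (min_le_left _ _))
  have h2 : ∀ j, edist (lam j (v j)) (v j) < ENNReal.ofReal ρ := fun j =>
    ((le_iSup₂ (f := fun j t => edist (lam j t) t) j (v j)).trans (le_max_right _ _)).trans_lt
      (hlam.trans_le (min_le_right _ _))
  rw [edist_dist, ENNReal.ofReal_lt_ofReal_iff (half_pos hδ), Real.dist_eq] at h1
  have h3 : dist (timeChange lam v) v < ρ := by
    rw [dist_pi_lt_iff hρ]
    intro j
    have := h2 j
    rwa [edist_dist, ENNReal.ofReal_lt_ofReal_iff hρ] at this
  have h4 := hρ' h3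
  rw [Real.dist_eq] at h4
  calc |w v - z v| = |(w v - z (timeChange lam v)) + (z (timeChange lam v) - z v)| := by ring_nf
    _ ≤ _ := abs_add_le _ _
    _ ≤ δ := by linarith

/-- The functions for which the detector stops before the end of the sample. -/
def exceedanceSet (b : Fin 3 → ℝ) (τ : Fin 3 → ℕ → ℝ) (T : Fin 3 → ℝ) (s₀ c : ℝ) (n : Fin 3 → ℕ) :
    Set (SkorohodSpace 3) :=
  {w | ∃ k : ℕ, ⌊(n 0 : ℝ) * s₀⌋₊ ≤ k ∧ k < n 0 ∧
    ∃ x ∈ monitoringRegion T ((k : ℝ) / n 0), c < |gridSum b τ n w k x|}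

/-- The strict inequality excludes stopping at `k = n 0`, although the detector allows it; hence `k
< n 0` in `exceedanceSet`. -/
theorem setOf_globalDetector_div_lt_one {Ω : Type*} (b : Fin 3 → ℝ) (τ : Fin 3 → ℕ → ℝ)
    (T : Fin 3 → ℝ) (f f₀ : (Fin 3 → ℝ) → ℝ)
    (hf : ∀ n, ∀ l ∈ indexBox n, f (samplePoint τ n l) = f₀ (samplePoint τ n l))
    (ε : (Fin 3 → ℤ) → Ω → ℝ) (s₀ : ℝ) {c : ℝ} (hc : 0 < c) {n : Fin 3 → ℕ} (hn : ∀ j, 0 < n j) :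
    {ω | (globalDetector b f₀ τ T s₀ c n (observation f τ ε n ω) : ℝ≥0∞) / (n 0 : ℝ≥0∞) < 1} =
      partialSumProcess ε n ⁻¹' exceedanceSet b τ T s₀ c n := by
  ext ω
  have hn0 : (n 0 : ℝ≥0∞) ≠ 0 := by exact_mod_cast (hn 0).ne'
  rw [Set.mem_ofPred_eq, ENNReal.div_lt_iff (Or.inl hn0) (Or.inl (ENNReal.natCast_ne_top _)), one_mul,
    ← ENat.toENNReal_coe, ENat.toENNReal_lt, globalDetector]
  simp only [iInf_lt_iff, Set.mem_ofPred_eq, Set.mem_preimage, exceedanceSet, lt_iSup_iff,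
    exists_prop, Nat.cast_lt]
  have key : ∀ k ≤ n 0, ∀ x, (ENNReal.ofReal c <
      ‖detectionProc b f₀ τ n (observation f τ ε n ω) ((k : ℝ) / n 0) x‖ₑ ↔
      c < |gridSum b τ n (partialSumProcess ε n ω) k x|) := by
    intro k hk x
    rw [detectionProc_eq_gridSum b τ f f₀ hf ε n hn ω k hk x, ← ofReal_norm, Real.norm_eq_abs,
      ENNReal.ofReal_lt_ofReal_iff_of_nonneg hc.le]
    rfl
  constructor
  · rintro ⟨k, ⟨h1, h2, x, hx, h3⟩, h4⟩
    exact ⟨k, h1, h4, x, hx, (key k h2 x).1 h3⟩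
  · rintro ⟨k, h1, h4, x, hx, h3⟩
    exact ⟨k, ⟨h1, h4.le, x, hx, (key k h4.le x).2 h3⟩, h4⟩

section Exceedance

variable {b : Fin 3 → ℝ} {τ : Fin 3 → ℕ → ℝ} {T : Fin 3 → ℝ} {s₀ c : ℝ} {z : SkorohodSpace 3}

/-- A Skorohod ball around a continuous `z` is uniformly close to `z`; the uniform bound handles `w
- z` and the grid limit handles `z`. The radius does not depend on `n`. -/
theorem exists_forall_abs_gridSum_sub_le (b : Fin 3 → ℝ) (hτ : ∀ j m, 0 < m → 0 < τ j m)
    (hT : ∀ j, 0 < T j) (hτT : ∀ j, Tendsto (fun m : ℕ => (m : ℝ) * τ j m) atTop (𝓝 (T j)))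
    (hz : Continuous (z : (Fin 3 → I) → ℝ)) {δ : ℝ} (hδ : 0 < δ) :
    ∃ η : ℝ≥0∞, 0 < η ∧ ∀ᶠ n in atTop, ∀ w : SkorohodSpace 3, edist w z < η → ∀ k ≤ n 0,
      ∀ x ∈ Set.Icc 0 T, |gridSum b τ n w k x - limitFunctional b τ z ((k : ℝ) / n 0) x| ≤ δ := by
  obtain ⟨C, hC, hbound⟩ := exists_abs_gridSum_le b hτ hT hτT
  obtain ⟨η, hη, hη'⟩ := exists_forall_edist_lt_abs_sub_le hz (δ := δ / 2 / C) (by positivity)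
  refine ⟨η, hη, ?_⟩
  have hlim := Metric.tendsto_nhds.1 (isGridLimit_limitFunctional b hτ hT hτT hz).tendsto
    (δ / 2) (half_pos hδ)
  rw [eventually_monitoringFilter] at hlim
  filter_upwards [hbound, hlim] with n h1 h2 w hw k hk x hx
  have e1 := h1 (fun v => w v - z v) _ (hη' w hw) k hk x
  rw [gridSum_sub, mul_div_cancel₀ _ hC.ne'] at e1
  have e2 := h2 k hk x hx
  rw [Real.dist_eq, sub_zero] at e2
  calc |gridSum b τ n w k x - limitFunctional b τ z ((k : ℝ) / n 0) x|
      = |(gridSum b τ n w k x - gridSum b τ n z k x) +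
        (gridSum b τ n z k x - limitFunctional b τ z ((k : ℝ) / n 0) x)| := by ring_nf
    _ ≤ _ := abs_add_le _ _
    _ ≤ δ := by linarith

theorem exists_of_mem_tailClosure {E : (Fin 3 → ℕ) → Set (SkorohodSpace 3)}
    (h : ∀ N, z ∈ tailClosure E N) {p : (Fin 3 → ℕ) → Prop} (hp : ∀ᶠ n in atTop, p n) {η : ℝ≥0∞}
    (hη : 0 < η) : ∃ n w, p n ∧ w ∈ E n ∧ edist w z < η := by
  obtain ⟨N, hN⟩ := exists_nat_of_eventually_atTop hp
  obtain ⟨w, hw, hwz⟩ := EMetric.mem_closure_iff.1 (h N) η hη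
  obtain ⟨n, hn, hwn⟩ := Set.mem_iUnion₂.1 hw
  exact ⟨n, w, hN n hn, hwn, by rwa [edist_comm]⟩

theorem monitoringRegion_mono (hT : ∀ j, 0 < T j) {s s' : ℝ} (h : s ≤ s') :
    monitoringRegion T s ⊆ monitoringRegion T s' := fun _ hx =>
  ⟨⟨hx.1.1, hx.1.2.trans (mul_le_mul_of_nonneg_right h (hT 0).le)⟩, hx.2⟩

theorem exists_lt_of_mem_tailClosure (b : Fin 3 → ℝ) (hτ : ∀ j m, 0 < m → 0 < τ j m)
    (hT : ∀ j, 0 < T j) (hτT : ∀ j, Tendsto (fun m : ℕ => (m : ℝ) * τ j m) atTop (𝓝 (T j)))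
    (hs₀ : 0 < s₀) (hs₀' : s₀ < 1) (hz : Continuous (z : (Fin 3 → I) → ℝ))
    (h : ∀ N, z ∈ tailClosure (exceedanceSet b τ T s₀ c) N) {δ : ℝ} (hδ : 0 < δ) :
    ∃ p ∈ monitoringDomain T s₀, c - δ < |limitFunctional b τ z p.1 p.2| := by
  have hcont := (isGridLimit_limitFunctional b hτ hT hτT hz).continuousOn
  have huc := (isCompact_Icc.prod isCompact_Icc : IsCompact (Set.Icc (0 : ℝ) 1 ×ˢ
    Set.Icc (0 : Fin 3 → ℝ) T)).uniformContinuousOn_of_continuous hcont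
  obtain ⟨ρ, hρ, hρ'⟩ := Metric.uniformContinuousOn_iff.1 huc (δ / 2) (half_pos hδ)
  obtain ⟨η, hη, hclose⟩ := exists_forall_abs_gridSum_sub_le b hτ hT hτT hz (half_pos hδ)
  have hsmall : ∀ᶠ n : Fin 3 → ℕ in atTop, 1 / (n 0 : ℝ) < ρ / 2 :=
    (tendsto_one_div_atTop_nhds_zero_nat.comp (tendsto_eval_atTop_nat 0)).eventually_lt_const
      (half_pos hρ)
  obtain ⟨n, w, ⟨hn1, hn2, hn3⟩, ⟨k, hk1, hk2, x, hx, hxc⟩, hwz⟩ :=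
    exists_of_mem_tailClosure h (hclose.and (hsmall.and eventually_forall_pos)) hη
  have hn0 : (0 : ℝ) < n 0 := by exact_mod_cast hn3 0
  have hkI := div_mem_Icc hk2.le
  have hxT := monitoringRegion_subset hT hkI.2 hx
  -- The stopping time `k / n 0` may fall below `s₀` by up to `1 / n 0`, while the limit domain
  -- requires `s > s₀`. Moving to `max (k / n 0) r` costs less than `ρ`, and `x` stays admissible
  -- because the region grows with time.
  set r : ℝ := s₀ + min (ρ / 2) (1 - s₀) with hr
  have hr0 : s₀ < r := by
    have : 0 < min (ρ / 2) (1 - s₀) := lt_min (half_pos hρ) (by linarith)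
    linarith
  have hr1 : r ≤ 1 := by linarith [min_le_right (ρ / 2) (1 - s₀)]
  have hr2 : r ≤ s₀ + ρ / 2 := by linarith [min_le_left (ρ / 2) (1 - s₀)]
  have hs : max ((k : ℝ) / n 0) r ∈ Set.Ioc s₀ 1 := ⟨lt_max_of_lt_right hr0, max_le hkI.2 hr1⟩
  have hkn : s₀ - 1 / n 0 < (k : ℝ) / n 0 := by
    rw [lt_div_iff₀ hn0, sub_mul, one_div, inv_mul_cancel₀ hn0.ne']
    have h1 := Nat.lt_floor_add_one ((n 0 : ℝ) * s₀)
    have h2 : (⌊(n 0 : ℝ) * s₀⌋₊ : ℝ) ≤ k := by exact_mod_cast hk1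
    linarith
  refine ⟨(max ((k : ℝ) / n 0) r, x), ⟨hs, monitoringRegion_mono hT (le_max_left _ _) hx⟩, ?_⟩
  have hd : dist ((k : ℝ) / n 0, x) (max ((k : ℝ) / n 0) r, x) < ρ := by
    rw [Prod.dist_eq, dist_self, max_eq_left dist_nonneg, Real.dist_eq, abs_sub_comm,
      abs_of_nonneg (sub_nonneg.2 (le_max_left _ _)), sub_lt_iff_lt_add]
    exact max_lt (by linarith) (by linarith)
  have h1 := hρ' _ ⟨hkI, hxT⟩ _ ⟨⟨hs₀.le.trans hs.1.le, hs.2⟩, hxT⟩ hd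
  have h2 := hn1 w hwz k hk2.le x hxT
  rw [Real.dist_eq] at h1
  simp only at h1 ⊢
  have h3 := abs_sub_abs_le_abs_sub (gridSum b τ n w k x)
    (limitFunctional b τ z ((k : ℝ) / n 0) x)
  have h4 := abs_sub_abs_le_abs_sub (limitFunctional b τ z ((k : ℝ) / n 0) x)
    (limitFunctional b τ z (max ((k : ℝ) / n 0) r) x)
  linarith

theorem not_lt_of_mem_tailClosure (b : Fin 3 → ℝ) (hτ : ∀ j m, 0 < m → 0 < τ j m)
    (hT : ∀ j, 0 < T j) (hτT : ∀ j, Tendsto (fun m : ℕ => (m : ℝ) * τ j m) atTop (𝓝 (T j)))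
    (hs₀ : 0 < s₀) (hs₀' : s₀ < 1) (hz : Continuous (z : (Fin 3 → I) → ℝ))
    (h : ∀ N, z ∈ tailClosure (fun n => (exceedanceSet b τ T s₀ c n)ᶜ) N)
    {p : ℝ × (Fin 3 → ℝ)} (hp : p ∈ monitoringDomain T s₀) :
    |limitFunctional b τ z p.1 p.2| ≤ c := by
  by_contra! hlt
  obtain ⟨⟨hs1, hs2⟩, hx⟩ := hp
  obtain ⟨s, x⟩ := p
  simp only at hs1 hs2 hx hlt
  have hs0 : 0 ≤ s := hs₀.le.trans hs1.le
  set δ := (|limitFunctional b τ z s x| - c) / 2 with hδ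
  have hδ0 : 0 < δ := by
    rw [hδ]
    linarith
  have hcont := (isGridLimit_limitFunctional b hτ hT hτT hz).continuousOn
  obtain ⟨η, hη, hclose⟩ := exists_forall_abs_gridSum_sub_le b hτ hT hτT hz hδ0
  -- The cap `n 0 - 1` is needed when `s = 1`, since an exceedance must occur strictly before the
  -- end of the sample.
  set k : (Fin 3 → ℕ) → ℕ := fun n => min ⌊(n 0 : ℝ) * s⌋₊ (n 0 - 1) with hk
  have hkle : ∀ n, k n ≤ n 0 := fun n => (min_le_right _ _).trans (Nat.sub_le _ _)
  have hklim : Tendsto (fun n : Fin 3 → ℕ => (k n : ℝ) / n 0) atTop (𝓝 s) := by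
    have h1 : Tendsto (fun n : Fin 3 → ℕ => 1 - 1 / (n 0 : ℝ)) atTop (𝓝 1) := by
      simpa [Function.comp_def] using ((tendsto_one_div_atTop_nhds_zero_nat (𝕜 := ℝ)).comp
        (tendsto_eval_atTop_nat 0)).const_sub (1 : ℝ)
    have h2 := (tendsto_floor_mul_div hs0).min h1
    rw [min_eq_left hs2] at h2
    refine h2.congr' ?_
    filter_upwards [eventually_forall_pos] with n hn
    have hn0 : (0 : ℝ) < n 0 := by exact_mod_cast hn 0
    have e : (1 : ℝ) - 1 / n 0 = ((n 0 - 1 : ℕ) : ℝ) / n 0 := by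
      rw [Nat.cast_sub (hn 0)]
      field_simp
      simp
    simp only [e, hk, Nat.cast_min, min_div_div_right hn0.le]
  -- As `k n / n 0` can be smaller than `s`, the first coordinate is truncated to keep the point in
  -- the monitored region.
  set y : (Fin 3 → ℕ) → Fin 3 → ℝ :=
    fun n => Function.update x 0 (min (x 0) ((k n : ℝ) / n 0 * T 0)) with hy
  have hyreg : ∀ n, y n ∈ monitoringRegion T ((k n : ℝ) / n 0) := by
    intro n
    refine ⟨⟨?_, ?_⟩, ?_, ?_⟩
    · have h1 : 0 ≤ (k n : ℝ) / n 0 * T 0 := mul_nonneg (by positivity) (hT 0).le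
      simpa [hy] using ⟨hx.1.1, h1⟩
    · simp [hy]
    · simpa [hy] using hx.2.1
    · simpa [hy] using hx.2.2
  have hylim : Tendsto y atTop (𝓝 x) := by
    have h1 : Tendsto (fun n => min (x 0) ((k n : ℝ) / n 0 * T 0)) atTop (𝓝 (x 0)) := by
      have h2 := (tendsto_const_nhds (x := x 0)).min (hklim.mul_const (T 0))
      rwa [min_eq_left hx.1.2] at h2
    have h3 := (tendsto_const_nhds (x := x)).update 0 h1
    rwa [Function.update_eq_self] at h3
  have hmem : ∀ n, ((k n : ℝ) / n 0, y n) ∈ Set.Icc (0 : ℝ) 1 ×ˢ Set.Icc 0 T := fun n =>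
    ⟨div_mem_Icc (hkle n), monitoringRegion_subset hT (div_mem_Icc (hkle n)).2 (hyreg n)⟩
  have hL : Tendsto (fun n => |limitFunctional b τ z ((k n : ℝ) / n 0) (y n)|) atTop
      (𝓝 |limitFunctional b τ z s x|) :=
    (((hcont (s, x) ⟨⟨hs0, hs2⟩, monitoringRegion_subset hT hs2 hx⟩).tendsto.comp
      (tendsto_nhdsWithin_iff.2 ⟨hklim.prodMk_nhds hylim, Eventually.of_forall hmem⟩))).abs
  have hev : ∀ᶠ n in atTop, c + δ < |limitFunctional b τ z ((k n : ℝ) / n 0) (y n)| :=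
    hL.eventually_const_lt (by rw [hδ]; linarith)
  obtain ⟨n, w, ⟨hn1, hn2, hn3⟩, hw, hwz⟩ :=
    exists_of_mem_tailClosure h (hclose.and (hev.and eventually_forall_pos)) hη
  refine hw ⟨k n, ?_, ?_, y n, hyreg n, ?_⟩
  · refine le_min (Nat.floor_mono (mul_le_mul_of_nonneg_left hs1.le (Nat.cast_nonneg _))) ?_
    have hn0 : (0 : ℝ) < n 0 := by exact_mod_cast hn3 0
    have : ⌊(n 0 : ℝ) * s₀⌋₊ < n 0 := (Nat.floor_lt (by positivity)).2
      (mul_lt_of_lt_one_right hn0 hs₀')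
    omega
  · have := hn3 0
    have : k n ≤ n 0 - 1 := min_le_right _ _
    omega
  · have h2 := hn1 w hwz (k n) (hkle n) (y n) (hmem n).2
    rw [abs_sub_comm] at h2
    have h3 := abs_sub_abs_le_abs_sub (limitFunctional b τ z ((k n : ℝ) / n 0) (y n))
      (gridSum b τ n w (k n) (y n))
    linarith

end Exceedance

end

/-! ### The main theorem. -/

theorem mainTheorem9 {Ω Ω' : Type*} [MeasurableSpace Ω] [MeasurableSpace Ω']
    (P : Measure Ω) [IsProbabilityMeasure P] (P' : Measure Ω') [IsProbabilityMeasure P']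
    -- the noise field, and the scale and the Brownian motion of its functional limit theorem
    (ε : (Fin 3 → ℤ) → Ω → ℝ) (sig : ℝ) (B : Ω' → SkorohodSpace 3)
    (hsig : 0 < sig)
    (hε : IsCenteredWeaklyStationary ε P)
    (hB : IsBrownianSheet (fun ω => (B ω : (Fin 3 → I) → ℝ)) P')
    (hclt : TendstoInDistribution (partialSumProcess ε) atTop (fun ω => sig • B ω) (fun _ => P) P')
    -- sampling periods and their limits
    (τ : Fin 3 → ℕ → ℝ) (T : Fin 3 → ℝ)
    (hτ : ∀ j m, 0 < m → 0 < τ j m) (hT : ∀ j, 0 < T j)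
    (hτT : ∀ j, Tendsto (fun m : ℕ => (m : ℝ) * τ j m) atTop (𝓝 (T j)))
    -- signal and reference signal under the null hypothesis
    (f f₀ : (Fin 3 → ℝ) → ℝ)
    (hH₀ : ∀ x, (x ∈ Set.Icc 0 T ∨ ∃ n, ∃ l ∈ indexBox n, x = samplePoint τ n l) → f x = f₀ x)
    -- band widths, start of monitoring, control limit
    (b : Fin 3 → ℝ) (hb : ∀ j, 0 < b j)
    (s₀ : ℝ) (hs₀ : 0 < s₀) (hs₀' : s₀ < 1)
    (c : ℝ) (hc : 0 < c) :
    (∃ F : ℝ → (Fin 3 → ℝ) → Ω' → ℝ, IsLimitProcess b T sig s₀ F P') ∧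
    ∀ {Ω'' : Type*} [MeasurableSpace Ω''] (Q : Measure Ω'') [IsProbabilityMeasure Q]
      (F : ℝ → (Fin 3 → ℝ) → Ω'' → ℝ), IsLimitProcess b T sig s₀ F Q →
      Tendsto
        (fun n : Fin 3 → ℕ =>
          P {ω | (globalDetector b f₀ τ T s₀ c n (observation f τ ε n ω) : ℝ≥0∞) / (n 0 : ℝ≥0∞) < 1})
        atTop
        (𝓝 (Q {ω | ENNReal.ofReal c <
          ⨆ s ∈ Set.Ioc s₀ 1, ⨆ x ∈ monitoringRegion T s, ‖F s x ω‖ₑ})) := by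
  have hlim := hB.isLimitProcess b hτ hT hτT sig hs₀
  refine ⟨⟨_, hlim⟩, ?_⟩
  intro Ω'' _ Q _ F hF
  have : Nonempty (monitoringDomain T s₀) := (monitoringDomain_nonempty hT hs₀').to_subtype
  set d : ℕ → monitoringDomain T s₀ := TopologicalSpace.denseSeq _ with hd
  have hdense : DenseRange d := TopologicalSpace.denseRange_denseSeq _
  set F₀ : ℝ → (Fin 3 → ℝ) → Ω' → ℝ :=
    fun s x ω => limitFunctional b τ (fun v => sig * B ω v) s x with hF₀
  -- The limit probability is moved from the given process to the one built from `B`, so that paths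
  -- of `B` can be compared with tail closures.
  have hQ : Q {ω | ENNReal.ofReal c <
      ⨆ s ∈ Set.Ioc s₀ 1, ⨆ x ∈ monitoringRegion T s, ‖F s x ω‖ₑ} =
      P' {ω | ENNReal.ofReal c < ⨆ i, ‖F₀ (d i).1.1 (d i).1.2 ω‖ₑ} := by
    rw [← hF.measure_lt_iSup hlim hT d]
    refine measure_congr ?_
    filter_upwards [hF.continuous_paths] with ω hω
    refine propext ?_
    change _ < _ ↔ _ < _
    rw [iSup_monitoringDomain_eq_iSup_denseRange hT (f := fun s x => F s x ω) hω hdense]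
  rw [hQ]
  have hmeas : NullMeasurableSet {ω | ENNReal.ofReal c < ⨆ i, ‖F₀ (d i).1.1 (d i).1.2 ω‖ₑ} P' := by
    refine nullMeasurableSet_lt aemeasurable_const (AEMeasurable.iSup fun i => ?_)
    exact (hlim.gaussian.aemeasurable ⟨(d i).1, monitoringDomain_subset hT s₀ (d i).2⟩).enorm
  have hatom : ∀ᵐ ω ∂P', ⨆ i, ‖F₀ (d i).1.1 (d i).1.2 ω‖ₑ ≠ ENNReal.ofReal c := by
    rw [ae_iff]
    simpa using hlim.measure_iSup_eq_zero hb hT hsig hs₀ hc d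
  have hsup : ∀ ω, Continuous (B ω : (Fin 3 → I) → ℝ) → ∀ r, (ENNReal.ofReal r <
      ⨆ i, ‖F₀ (d i).1.1 (d i).1.2 ω‖ₑ ↔ ∃ p ∈ monitoringDomain T s₀,
        ENNReal.ofReal r < ‖F₀ p.1 p.2 ω‖ₑ) := by
    intro ω hω r
    have hcont : ContinuousOn (fun p : ℝ × (Fin 3 → ℝ) => F₀ p.1 p.2 ω)
        (Set.Icc s₀ 1 ×ˢ Set.Icc 0 T) :=
      (isGridLimit_limitFunctional b hτ hT hτT (w := fun v => sig * B ω v)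
        (continuous_const.mul hω)).continuousOn.mono
        (Set.prod_mono (Set.Icc_subset_Icc_left hs₀.le) le_rfl)
    rw [← iSup_monitoringDomain_eq_iSup_denseRange hT (f := fun s x => F₀ s x ω) hcont hdense,
      iSup_monitoringDomain fun s x => ‖F₀ s x ω‖ₑ, lt_iSup_iff]
    exact ⟨fun ⟨p, hp⟩ => ⟨p.1, p.2, hp⟩, fun ⟨p, hp, hp'⟩ => ⟨⟨p, hp⟩, hp'⟩⟩
  have hconv : ∀ ω, Continuous (B ω : (Fin 3 → I) → ℝ) →
      Continuous ((sig • B ω : SkorohodSpace 3) : (Fin 3 → I) → ℝ) := fun ω hω =>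
    continuous_const.mul hω
  have hmain := tendsto_measure_preimage (E := exceedanceSet b τ T s₀ c) hclt hmeas ?_ ?_
  · refine hmain.congr' ?_
    filter_upwards [eventually_forall_pos] with n hn
    rw [setOf_globalDetector_div_lt_one b τ T f f₀
      (fun n l hl => hH₀ _ (Or.inr ⟨n, l, hl, rfl⟩)) ε s₀ hc hn]
  · filter_upwards [hB.continuous_paths, hatom] with ω hω hne hmem
    -- Tail closures yield points with values above `c - δ` for every `δ > 0`, hence only a supremum
    -- of at least `c`; the absence of an atom makes this strict.
    refine lt_of_le_of_ne ?_ hne.symm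
    refine le_of_forall_lt fun a ha => ?_
    have ha' : a.toReal < c := by
      rwa [← ENNReal.ofReal_toReal ha.ne_top, ENNReal.ofReal_lt_ofReal_iff hc] at ha
    obtain ⟨p, hp, hpc⟩ := exists_lt_of_mem_tailClosure b hτ hT hτT hs₀ hs₀' (hconv ω hω) hmem
      (sub_pos.2 ha')
    rw [← ENNReal.ofReal_toReal ha.ne_top, hsup ω hω]
    refine ⟨p, hp, ?_⟩
    rw [← ofReal_norm, Real.norm_eq_abs, ENNReal.ofReal_lt_ofReal_iff_of_nonneg ENNReal.toReal_nonneg]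
    have h1 : c - (c - a.toReal) = a.toReal := by ring
    rw [h1] at hpc
    exact hpc
  · filter_upwards [hB.continuous_paths] with ω hω hmem hlt
    obtain ⟨p, hp, hpc⟩ := (hsup ω hω c).1 hlt
    rw [← ofReal_norm, Real.norm_eq_abs, ENNReal.ofReal_lt_ofReal_iff_of_nonneg hc.le] at hpc
    exact absurd hpc (not_lt.2
      (not_lt_of_mem_tailClosure b hτ hT hτT hs₀ hs₀' (hconv ω hω) hmem hp))
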